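/- \textbf{Model.} Let $n\ge 1$ nodes be assigned to $k\ge 1$ blocks by $c_1,\dots,c_n\in\{1,\dots,k\}$, and let $\mu,\alpha,\beta$ be symmetric $k\times k$ matrices with $\mu_{ab}\ge 0$ and $\alpha_{ab},\beta_{ab}>0$. In the undirected CHIP$(C,n,k,\mu,\alpha,\beta)$ model (Community Hawkes Independent Pairs; $C$ is the binary assignment matrix of $c$), each unordered pair of distinct nodes $\{i,j\}$ generates events at the times of a univariate Hawkes process started at time $0$ with conditional intensity $$\lambda(t)=\mu_{c_ic_j}+\sum_{t_q<t}\alpha_{c_ic_j}e^{-\beta_{c_ic_j}(t-t_q)},$$ and these processes are independent for different pairs. For $T>0$ let $N_{ij}(T)$ be the number of events between $i$ and $j$ up to time $T$, and let $A$ be the symmetric binary adjacency matrix with $A_{ij}=1\{N_{ij}(T)>0\}$ for $i\ne j$ and $A_{ii}=0$. Let $E[A]$ denote the $n\times n$ block matrix with entries $1-e^{-\mu_{c_ic_j}T}$ for all $i,j$, including the diagonal; for $i\neq j$ its entries are the expectations of the $A_{ij}$. Assume that $E[A]$ has rank $k$, and let $\lambda_{\min}(E[A])$ be its nonzero eigenvalue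 that is smallest in absolute value. Let $|a|_{\max}$ be the size of the largest block, $\mu_{\max}=\max_{a,b}\mu_{ab}$, and, for a constant $c_0>0$, $$\Delta=\max\{\,n(1-e^{-\mu_{\max}T}),\;c_0\log n\,\}.$$ \textbf{Spectral clustering.} Let the columns of $\hat U\in\mathbb R^{n\times k}$ be orthonormal eigenvectors of $A$ for $k$ eigenvalues largest in absolute value, and let $\hat c$ be the labels of a $(1+\epsilon)$-approximate solution, $\epsilon>0$, of the $k$-means problem for the rows of $\hat U$, i.e. a solution with cost at most $(1+\epsilon)$ times the minimum. The misclustering rate is $r_A=\min_{\Pi}\frac1n\sum_{i=1}^n 1\{c_i\neq\Pi(\hat c_i)\}$, the minimum being over permutations $\Pi$ of the labels. \textbf{Theorem.} For all $c_0>0$ and $r>0$ there is a constant $c>0$, depending only on $c_0$ and $r$, such that for every model as above, every $T>0$ with $\operatorname{rank}E[A]=k$ and every $\epsilon>0$, with probability at least $1-n^{-r}$ every such output $\hat c$ of spectral clustering on $A$ has $$r_A\le 64(2+\epsilon)\,\frac{|a|_{\max}\,k\,c\,\Delta}{n\,\lambda_{\min}(E[A])^2}.$$ -/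

import Mathlib

open MeasureTheory ProbabilityTheory
open scoped ENNReal NNReal

namespace CHIP

noncomputable section

/-! ### Exponential Hawkes processes

A point process on the positive half line is given by its ordered arrival times
`τ 0 < τ 1 < τ 2 < ...`, where the value `⊤` of `τ q` says that there are at most `q` events. -/

/-- The conditional intensity at time `u` given the first `q` arrival times `s 0, ..., s (q - 1)`:
`μ + ∑_{s i < u} α exp (-β (u - s i))`. -/
def intensity (μ α β : ℝ) (q : ℕ) (s : ℕ → ℝ≥0∞) (u : ℝ) : ℝ :=
  μ + ∑ i ∈ Finset.range q,
    if (s i).toReal < u then α * Real.exp (-β * (u - (s i).toReal)) else 0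

/-- The time of the last of the first `q` events; the starting time `0` if `q = 0`. -/
def lastTime (s : ℕ → ℝ≥0∞) : ℕ → ℝ≥0∞
  | 0 => 0
  | q + 1 => s q

/-- The information carried by the first `q` arrival times. -/
@[reducible] def pastSigma {Ω : Type*} (τ : ℕ → Ω → ℝ≥0∞) (q : ℕ) : MeasurableSpace Ω :=
  ⨆ i : Fin q, MeasurableSpace.comap (τ i) inferInstance

/-- `τ` are the arrival times of a univariate Hawkes process with background intensity `μ` and
kernel `t ↦ α exp (-β t)`, started from the empty history at time `0`. Given the first `q`
events, the next one occurs with hazard rate `intensity μ α β q`: the conditional probability that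
it occurs after `t` is the exponential of minus the intensity integrated from the last event
to `t`. -/
structure IsHawkes {Ω : Type*} [MeasurableSpace Ω] (P : Measure Ω) (μ α β : ℝ)
    (τ : ℕ → Ω → ℝ≥0∞) : Prop where
  measurable : ∀ q, Measurable (τ q)
  pos : ∀ᵐ ω ∂P, 0 < τ 0 ω
  increasing : ∀ᵐ ω ∂P, ∀ q, τ q ω < ⊤ → τ q ω < τ (q + 1) ω
  stays_top : ∀ᵐ ω ∂P, ∀ q, τ q ω = ⊤ → τ (q + 1) ω = ⊤
  survival : ∀ (q : ℕ) (t : ℝ≥0), ∀ᵐ ω ∂P,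
    lastTime (fun i => τ i ω) q ≤ (t : ℝ≥0∞) →
      (P⟦{ω' | (t : ℝ≥0∞) < τ q ω'} | pastSigma τ q⟧) ω =
        Real.exp (-∫ u in (lastTime (fun i => τ i ω) q).toReal..(t : ℝ),
          intensity μ α β q (fun i => τ i ω) u)

/-! ### The undirected CHIP model -/

/-- `t i j` are the times of the events between the nodes `i` and `j` in the undirected CHIP model
with `n` nodes, `k` blocks, block assignment `c` and Hawkes parameters `μ`, `α`, `β`: one Hawkes
process for each unordered pair of distinct nodes, independent of one another, with the parameters
of its block pair. -/
structure IsCHIP {Ω : Type*} [MeasurableSpace Ω] (P : Measure Ω) {n k : ℕ}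
    (c : Fin n → Fin k) (μ α β : Matrix (Fin k) (Fin k) ℝ)
    (t : Fin n → Fin n → ℕ → Ω → ℝ≥0∞) : Prop where
  mu_nonneg : ∀ a b, 0 ≤ μ a b
  alpha_pos : ∀ a b, 0 < α a b
  beta_pos : ∀ a b, 0 < β a b
  mu_symm : μ.IsSymm
  alpha_symm : α.IsSymm
  beta_symm : β.IsSymm
  undirected : ∀ i j, t i j = t j i
  hawkes : ∀ i j, i ≠ j →
    IsHawkes P (μ (c i) (c j)) (α (c i) (c j)) (β (c i) (c j)) (t i j)
  indep : iIndepFun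
    (fun (p : {p : Fin n × Fin n // p.1 < p.2}) (ω : Ω) (q : ℕ) => t p.1.1 p.1.2 q ω) P

/-- The number of events up to time `T`. -/
def count (T : ℝ) (s : ℕ → ℝ≥0∞) : ℕ∞ := {q : ℕ | s q ≤ ENNReal.ofReal T}.encard

open Classical in
/-- The binary adjacency matrix of the events up to time `T`; there are no self-edges. -/
def adjacency {Ω : Type*} {n : ℕ} (T : ℝ) (t : Fin n → Fin n → ℕ → Ω → ℝ≥0∞) (ω : Ω) :
    Matrix (Fin n) (Fin n) ℝ :=
  Matrix.of fun i j => if i ≠ j ∧ 0 < count T (fun q => t i j q ω) then 1 else 0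

/-- The `n × n` matrix of edge probabilities, `1 - exp (-μ_{ab} T)` for nodes in the blocks `a`
and `b`. As usual for block models it is the full block matrix, whose diagonal carries the
probability of the block too, so that its rank is at most the number of blocks. -/
def meanAdjacency {n k : ℕ} (c : Fin n → Fin k) (μ : Matrix (Fin k) (Fin k) ℝ) (T : ℝ) :
    Matrix (Fin n) (Fin n) ℝ :=
  Matrix.of fun i j => 1 - Real.exp (-(μ (c i) (c j) * T))

/-- The smallest absolute value of a nonzero eigenvalue. -/
def lambdaMin {n : ℕ} (M : Matrix (Fin n) (Fin n) ℝ) : ℝ :=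
  sInf {x : ℝ | ∃ l : ℝ, l ≠ 0 ∧ Module.End.HasEigenvalue (Matrix.toLin' M) l ∧ x = |l|}

/-- The size of the largest block. -/
def maxBlockSize {n k : ℕ} (c : Fin n → Fin k) : ℕ :=
  Finset.univ.sup fun a : Fin k => (Finset.univ.filter fun i : Fin n => c i = a).card

/-- The largest entry. -/
def maxEntry {k : ℕ} (μ : Matrix (Fin k) (Fin k) ℝ) : ℝ := ⨆ p : Fin k × Fin k, μ p.1 p.2

/-- `Δ = max {n (1 - exp (-μ_max T)), c₀ log n}`. -/
def Delta (n : ℕ) {k : ℕ} (μ : Matrix (Fin k) (Fin k) ℝ) (T c₀ : ℝ) : ℝ :=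
  max (n * (1 - Real.exp (-(maxEntry μ * T)))) (c₀ * Real.log n)

/-! ### Spectral clustering -/

/-- The columns of `U` are orthonormal eigenvectors of `A` for `k` eigenvalues that are largest in
absolute value: they are `k` columns of an orthogonal matrix `V` that diagonalizes `A`. -/
def IsLeadingEigenvectors {n k : ℕ} (A : Matrix (Fin n) (Fin n) ℝ)
    (U : Matrix (Fin n) (Fin k) ℝ) : Prop :=
  ∃ (V : Matrix (Fin n) (Fin n) ℝ) (d : Fin n → ℝ) (f : Fin k ↪ Fin n),
    V ∈ Matrix.orthogonalGroup (Fin n) ℝ ∧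
    A * V = V * Matrix.diagonal d ∧
    (∀ a, ∀ b ∉ Set.range f, |d b| ≤ |d (f a)|) ∧
    ∀ i a, U i a = V i (f a)

/-- The `k`-means cost of clustering the rows of `U` with the labels `z` and the centers `X`. -/
def kmeansCost {n k : ℕ} (U : Matrix (Fin n) (Fin k) ℝ) (z : Fin n → Fin k)
    (X : Matrix (Fin k) (Fin k) ℝ) : ℝ :=
  ∑ i, ∑ l, (U i l - X (z i) l) ^ 2

/-- The labels `z` are a `(1 + ε)`-approximate solution of the `k`-means problem for the rows
of `U`. -/
def IsApproxKMeans {n k : ℕ} (ε : ℝ) (U : Matrix (Fin n) (Fin k) ℝ) (z : Fin n → Fin k) : Prop :=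
  ∃ X : Matrix (Fin k) (Fin k) ℝ, ∀ (z' : Fin n → Fin k) (X' : Matrix (Fin k) (Fin k) ℝ),
    kmeansCost U z X ≤ (1 + ε) * kmeansCost U z' X'

/-- `z` is a possible output of spectral clustering of `A` into `k` clusters: `(1 + ε)`-approximate
`k`-means on the rows of a matrix of `k` leading eigenvectors of `A`. -/
def IsSpectralClustering {n k : ℕ} (ε : ℝ) (A : Matrix (Fin n) (Fin n) ℝ)
    (z : Fin n → Fin k) : Prop :=
  ∃ U : Matrix (Fin n) (Fin k) ℝ, IsLeadingEigenvectors A U ∧ IsApproxKMeans ε U z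

/-- The misclustering rate: the fraction of wrongly labelled nodes, minimized over all
permutations of the labels. -/
def misclusteringRate {n k : ℕ} (c z : Fin n → Fin k) : ℝ :=
  ⨅ π : Equiv.Perm (Fin k),
    (1 / (n : ℝ)) * ((Finset.univ.filter fun i : Fin n => c i ≠ π (z i)).card : ℝ)

end

end CHIP

/-!
Write `P` for the block matrix `meanAdjacency c μ T` and `λ` for `lambdaMin P`. The proof consists of
a deterministic bound for spectral clustering in terms of the operator norm `‖A - P‖`, and of the
bound `‖A - P‖ ^ 2 ≤ C Δ` with high probability.

*Clustering.* The eigenvalues of `A` outside the `k` leading ones are at most `‖A - P‖`, because the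
kernel of `P` meets every space of dimension `k + 1` outside `0`. As `P` has rank `k`, block-constant vectors
are its range, on which it is bounded below by `λ`; hence each of them is in the span of the
leading eigenvectors `U` of `A` up to a relative error `2 ‖A - P‖ / λ` (`sin_theta_bound`). Applied to
the indicator vectors of the blocks this says that the rows of `U` have total squared distance at
most `4 k ‖A - P‖ ^ 2 / λ ^ 2` from their block means (`kmeansCost_blockMean_le`), and that the means of
the blocks `a` and `b` have squared distance at least `(1 / n_a + 1 / n_b) / 2`
(`blockMean_separated`). The centers found by approximate `k`-means can then be far from the block
means only for few nodes, and the other nodes of different blocks are separated. A block all of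
whose nodes are exceptional may cause another block to be split between two labels, which costs
a factor `2` (`exists_perm_card_misclustered_le`). If `‖A - P‖` is not small compared with `λ`, the
claimed bound exceeds `1`.

*Operator norm.* The entries of `A` are independent indicators: the first event of a Hawkes process
comes after an exponential time. For the centered matrix `X`, `E tr X ^ (2m)` is a sum over closed
walks in which every edge is traversed at least twice, and a walk with `e` edges contributes at
most `p ^ e`, where `p` is the largest edge probability (`integral_trace_pow_le`). Following an
idea of Bandeira and van Handel, the walks are not counted but compared, one pattern of
coincidences at a time, with the walks on only `2m` vertices, where `m ≥ n p`
(`sum_paired_walks_le`); the latter are bounded by the moments of a dense matrix of size `2m` whose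
independent entries take the values `2, -1, -1` with equal probability. Its norm is of order `√m` by
a net argument, since it is subgaussian and has size and moment of the same order
(`card_paired_walks_square_le`). With `m` of order `Δ`, which is at least of order `log n`, Markov's
inequality gives the tail bound (`measure_trace_pow_ge_le`).
-/

/-! ### Symmetric real matrices -/

section LinearAlgebra

open Matrix

variable {V W : Type*} [Fintype V] [Fintype W]

/-- The spectral theorem in terms of real matrices and transposes. -/
lemma Matrix.IsSymm.exists_orthogonal_diagonalization [DecidableEq V]
    {M : Matrix V V ℝ} (hM : M.IsSymm) :
    ∃ (Q : Matrix V V ℝ) (d : V → ℝ), Qᵀ * Q = 1 ∧ Q * Qᵀ = 1 ∧ M = Q * diagonal d * Qᵀ := by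
  have hH : M.IsHermitian := by
    rw [Matrix.IsHermitian, Matrix.conjTranspose_eq_transpose_of_trivial]; exact hM
  refine ⟨hH.eigenvectorUnitary, hH.eigenvalues, ?_, ?_, ?_⟩
  · have := (Matrix.mem_unitaryGroup_iff' (A := (hH.eigenvectorUnitary : Matrix V V ℝ))).1
      hH.eigenvectorUnitary.2
    rwa [star_eq_conjTranspose, conjTranspose_eq_transpose_of_trivial] at this
  · have := (Matrix.mem_unitaryGroup_iff (A := (hH.eigenvectorUnitary : Matrix V V ℝ))).1
      hH.eigenvectorUnitary.2
    rwa [star_eq_conjTranspose, conjTranspose_eq_transpose_of_trivial] at this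
  · have := hH.spectral_theorem
    rw [Unitary.conjStarAlgAut_apply, star_eq_conjTranspose,
      conjTranspose_eq_transpose_of_trivial] at this
    exact this

lemma mulVec_dotProduct_mulVec_of_transpose_mul_self [DecidableEq V]
    {Q : Matrix W V ℝ} (hQ : Qᵀ * Q = 1) (x : V → ℝ) : (Q *ᵥ x) ⬝ᵥ (Q *ᵥ x) = x ⬝ᵥ x := by
  rw [dotProduct_mulVec, ← mulVec_transpose, mulVec_mulVec, hQ, one_mulVec]

lemma dotProduct_self_eq_sum_sq (x : V → ℝ) : x ⬝ᵥ x = ∑ i, x i ^ 2 := by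
  simp [dotProduct, pow_two]

lemma dotProduct_self_nonneg_real (x : V → ℝ) : 0 ≤ x ⬝ᵥ x := by
  rw [dotProduct_self_eq_sum_sq]; positivity

lemma dotProduct_self_add_le (x y : V → ℝ) :
    (x + y) ⬝ᵥ (x + y) ≤ 2 * (x ⬝ᵥ x) + 2 * (y ⬝ᵥ y) := by
  simp only [dotProduct_self_eq_sum_sq, Pi.add_apply, Finset.mul_sum, ← Finset.sum_add_distrib]
  exact Finset.sum_le_sum fun i _ => by nlinarith [sq_nonneg (x i - y i)]

section Diagonalized

variable [DecidableEq V] {M Q : Matrix V V ℝ} {d : V → ℝ}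

lemma trace_pow_of_diagonalized (h1 : Qᵀ * Q = 1) (hM : M = Q * diagonal d * Qᵀ) (N : ℕ) :
    (M ^ N).trace = ∑ i, d i ^ N := by
  have h2 : Q * Qᵀ = 1 := mul_eq_one_comm.1 h1
  have hp : M ^ N = Q * diagonal (fun i => d i ^ N) * Qᵀ := by
    induction N with
    | zero =>
      have : (diagonal fun _ : V => (1 : ℝ)) = 1 := diagonal_one
      simp [this, h2]
    | succ N ih =>
      rw [pow_succ, ih, hM]
      calc _ = Q * (diagonal (fun i => d i ^ N) * (Qᵀ * Q) * diagonal d) * Qᵀ := by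
            simp only [Matrix.mul_assoc]
        _ = _ := by rw [h1, Matrix.mul_one, diagonal_mul_diagonal]; simp only [pow_succ]
  rw [hp, trace_mul_comm, ← Matrix.mul_assoc, h1, Matrix.one_mul, trace_diagonal]

lemma transpose_mulVec_mulVec_of_diagonalized (h1 : Qᵀ * Q = 1)
    (hM : M = Q * diagonal d * Qᵀ) (x : V → ℝ) (i : V) :
    (Qᵀ *ᵥ (M *ᵥ x)) i = d i * (Qᵀ *ᵥ x) i := by
  have : Qᵀ * M = diagonal d * Qᵀ := by
    rw [hM, Matrix.mul_assoc, ← Matrix.mul_assoc, h1, Matrix.one_mul]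
  rw [mulVec_mulVec, this, ← mulVec_mulVec, mulVec_diagonal]

lemma hasEigenvalue_of_diagonalized (h1 : Qᵀ * Q = 1) (hM : M = Q * diagonal d * Qᵀ) (i : V) :
    Module.End.HasEigenvalue (Matrix.toLin' M) (d i) := by
  refine Module.End.hasEigenvalue_of_hasEigenvector (x := Q *ᵥ Pi.single i 1) ?_
  refine Module.End.hasEigenvector_iff.2 ⟨Module.End.mem_eigenspace_iff.2 ?_, fun h => ?_⟩
  · rw [toLin'_apply, hM, ← mulVec_mulVec, ← mulVec_mulVec, mulVec_mulVec _ Qᵀ, h1, one_mulVec,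
      ← mulVec_smul]
    congr 1
    ext j
    by_cases hj : j = i
    · subst hj; simp [mulVec_diagonal]
    · simp [mulVec_diagonal, hj]
  · have := mulVec_dotProduct_mulVec_of_transpose_mul_self h1 (Pi.single i 1)
    rw [h] at this
    simp at this

end Diagonalized

/-- The `2m`-th Schatten norm bounds the operator norm. -/
lemma mulVec_dotProduct_le_of_trace_pow_le [DecidableEq V] {M : Matrix V V ℝ} (hM : M.IsSymm)
    {m : ℕ} (hm : m ≠ 0) {b : ℝ} (hb : 0 ≤ b) (h : (M ^ (2 * m)).trace ≤ b ^ m) (x : V → ℝ) :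
    (M *ᵥ x) ⬝ᵥ (M *ᵥ x) ≤ b * (x ⬝ᵥ x) := by
  obtain ⟨Q, d, h1, h2, rfl⟩ := hM.exists_orthogonal_diagonalization
  rw [trace_pow_of_diagonalized h1 rfl] at h
  have hd : ∀ i, d i ^ 2 ≤ b := fun i => by
    refine le_of_pow_le_pow_left₀ hm hb (le_trans ?_ h)
    rw [← pow_mul]
    exact Finset.single_le_sum (f := fun i => d i ^ (2 * m))
      (fun j _ => by rw [pow_mul]; positivity) (Finset.mem_univ i)
  have h2' : Qᵀᵀ * Qᵀ = 1 := by rwa [transpose_transpose]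
  rw [← mulVec_dotProduct_mulVec_of_transpose_mul_self h2',
    ← mulVec_dotProduct_mulVec_of_transpose_mul_self h2' x, dotProduct_self_eq_sum_sq,
    dotProduct_self_eq_sum_sq, Finset.mul_sum]
  refine Finset.sum_le_sum fun i _ => ?_
  rw [transpose_mulVec_mulVec_of_diagonalized h1 rfl, mul_pow]
  exact mul_le_mul_of_nonneg_right (hd i) (sq_nonneg _)

end LinearAlgebra

namespace CHIP

open Matrix

section LambdaMin

variable {n : ℕ} {M : Matrix (Fin n) (Fin n) ℝ}

lemma bddBelow_abs_eigenvalues : BddBelow {x : ℝ | ∃ l : ℝ, l ≠ 0 ∧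
    Module.End.HasEigenvalue (Matrix.toLin' M) l ∧ x = |l|} :=
  ⟨0, by rintro _ ⟨l, -, -, rfl⟩; exact abs_nonneg l⟩

lemma lambdaMin_pos (hM : M.IsSymm) (h0 : M ≠ 0) : 0 < lambdaMin M := by
  obtain ⟨Q, d, h1, h2, hQ⟩ := hM.exists_orthogonal_diagonalization
  have hne : {x : ℝ | ∃ l : ℝ, l ≠ 0 ∧
      Module.End.HasEigenvalue (Matrix.toLin' M) l ∧ x = |l|}.Nonempty := by
    by_contra hcon
    refine h0 ?_
    have hd : d = 0 := by
      ext i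
      by_contra hi
      exact hcon ⟨_, d i, hi, hasEigenvalue_of_diagonalized h1 hQ i, rfl⟩
    rw [hQ, hd]
    simp
  have hfin : {x : ℝ | ∃ l : ℝ, l ≠ 0 ∧
      Module.End.HasEigenvalue (Matrix.toLin' M) l ∧ x = |l|}.Finite := by
    refine ((Module.End.finite_hasEigenvalue (f := Matrix.toLin' M)).image abs).subset ?_
    rintro _ ⟨l, -, hl, rfl⟩
    exact ⟨l, hl, rfl⟩
  obtain ⟨l, hl, -, h⟩ := hne.csInf_mem hfin
  rw [lambdaMin, h]
  exact abs_pos.2 hl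

/-- On its range, a symmetric matrix is bounded below by `lambdaMin`. -/
lemma exists_mulVec_eq_of_mem_range (hM : M.IsSymm) (u : Fin n → ℝ) :
    ∃ y, M *ᵥ y = M *ᵥ u ∧
      lambdaMin M ^ 2 * (y ⬝ᵥ y) ≤ (M *ᵥ u) ⬝ᵥ (M *ᵥ u) := by
  obtain ⟨Q, d, h1, h2, hQ⟩ := hM.exists_orthogonal_diagonalization
  have h2' : Qᵀᵀ * Qᵀ = 1 := by rwa [transpose_transpose]
  have hlam : ∀ i, d i ≠ 0 → lambdaMin M ^ 2 ≤ d i ^ 2 := fun i hi => by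
    have h0 : 0 ≤ lambdaMin M :=
      Real.sInf_nonneg (by rintro _ ⟨l, -, -, rfl⟩; exact abs_nonneg l)
    have : lambdaMin M ≤ |d i| := csInf_le bddBelow_abs_eigenvalues
      ⟨d i, hi, hasEigenvalue_of_diagonalized h1 hQ i, rfl⟩
    rw [← sq_abs (d i)]
    gcongr
  -- the component of `u` orthogonal to the kernel
  set q : Fin n → ℝ := fun i => if d i = 0 then 0 else (Qᵀ *ᵥ u) i with hq
  have hQy : Qᵀ *ᵥ (Q *ᵥ q) = q := by rw [mulVec_mulVec, h1, one_mulVec]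
  refine ⟨Q *ᵥ q, ?_, ?_⟩
  · have : Qᵀ *ᵥ (M *ᵥ (Q *ᵥ q)) = Qᵀ *ᵥ (M *ᵥ u) := by
      ext i
      rw [transpose_mulVec_mulVec_of_diagonalized h1 hQ, hQy,
        transpose_mulVec_mulVec_of_diagonalized h1 hQ]
      by_cases hi : d i = 0 <;> simp [hq, hi]
    have := congrArg (fun v => Q *ᵥ v) this
    simpa only [mulVec_mulVec, ← Matrix.mul_assoc, h2, Matrix.one_mul] using this
  · rw [mulVec_dotProduct_mulVec_of_transpose_mul_self h1,
      ← mulVec_dotProduct_mulVec_of_transpose_mul_self h2' (M *ᵥ u),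
      dotProduct_self_eq_sum_sq, dotProduct_self_eq_sum_sq, Finset.mul_sum]
    refine Finset.sum_le_sum fun i _ => ?_
    rw [transpose_mulVec_mulVec_of_diagonalized h1 hQ, mul_pow]
    by_cases hi : d i = 0
    · simp [hq, hi]
    · simp only [hq, hi, if_false]
      exact mul_le_mul_of_nonneg_right (hlam i hi) (sq_nonneg _)

end LambdaMin

/-! ### Block matrices of full rank -/

section Block

variable {n k : ℕ}

/-- The binary `n × k` assignment matrix of the labels `c`. -/
def assignment (c : Fin n → Fin k) : Matrix (Fin n) (Fin k) ℝ :=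
  Matrix.of fun i a => if c i = a then 1 else 0

/-- The `n × n` matrix that takes the value `B a b` on the nodes of the blocks `a` and `b`. -/
def blockMatrix (c : Fin n → Fin k) (B : Matrix (Fin k) (Fin k) ℝ) :
    Matrix (Fin n) (Fin n) ℝ :=
  Matrix.of fun i j => B (c i) (c j)

/-- The number of nodes in a block. -/
def blockSize (c : Fin n → Fin k) (a : Fin k) : ℕ :=
  (Finset.univ.filter fun i : Fin n => c i = a).card

lemma blockSize_le (c : Fin n → Fin k) (a : Fin k) : blockSize c a ≤ maxBlockSize c :=
  Finset.le_sup (f := fun a : Fin k => (Finset.univ.filter fun i : Fin n => c i = a).card)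
    (Finset.mem_univ a)

lemma sum_blockSize (c : Fin n → Fin k) : ∑ a, blockSize c a = n := by
  have := Finset.card_eq_sum_card_fiberwise (f := c) (s := Finset.univ) (t := Finset.univ)
    (fun _ _ => Finset.mem_coe.2 (Finset.mem_univ _))
  simpa [blockSize] using this.symm

lemma assignment_mulVec (c : Fin n → Fin k) (v : Fin k → ℝ) (i : Fin n) :
    (assignment c *ᵥ v) i = v (c i) := by
  simp [assignment, mulVec, dotProduct]

lemma blockMatrix_eq (c : Fin n → Fin k) (B : Matrix (Fin k) (Fin k) ℝ) :
    blockMatrix c B = assignment c * B * (assignment c)ᵀ := by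
  ext i j
  simp [blockMatrix, assignment, Matrix.mul_apply]

variable {c : Fin n → Fin k} {B : Matrix (Fin k) (Fin k) ℝ}

lemma range_blockMatrix_eq (hrank : (blockMatrix c B).rank = k) :
    LinearMap.range (blockMatrix c B).mulVecLin = LinearMap.range (assignment c).mulVecLin := by
  refine Submodule.eq_of_le_of_finrank_le ?_ ?_
  · rintro _ ⟨u, rfl⟩
    refine ⟨B *ᵥ ((assignment c)ᵀ *ᵥ u), ?_⟩
    rw [mulVecLin_apply, mulVecLin_apply, mulVec_mulVec, mulVec_mulVec, blockMatrix_eq]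
  · have h1 : Module.finrank ℝ (LinearMap.range (blockMatrix c B).mulVecLin) = k := hrank
    rw [h1]
    exact (assignment c).rank_le_width

lemma blockSize_pos (hrank : (blockMatrix c B).rank = k) (a : Fin k) : 0 < blockSize c a := by
  by_contra h
  have hempty : ∀ i, c i ≠ a := fun i hi => h (Finset.card_pos.2 ⟨i, by simp [hi]⟩)
  have hfr := LinearMap.finrank_range_add_finrank_ker (assignment c).mulVecLin
  rw [← range_blockMatrix_eq hrank] at hfr
  have h1 : Module.finrank ℝ (LinearMap.range (blockMatrix c B).mulVecLin) = k := hrank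
  rw [h1, Module.finrank_fin_fun] at hfr
  have hker : LinearMap.ker (assignment c).mulVecLin = ⊥ :=
    Submodule.finrank_eq_zero.1 (by omega)
  have : (Pi.single a (1 : ℝ) : Fin k → ℝ) ∈ LinearMap.ker (assignment c).mulVecLin := by
    rw [LinearMap.mem_ker, mulVecLin_apply]
    ext i
    rw [assignment_mulVec]
    simp [hempty i]
  rw [hker, Submodule.mem_bot] at this
  simpa using congrFun this a

end Block

/-! ### Perturbation of the leading eigenvectors -/

section Perturbation

variable {n k : ℕ} {c : Fin n → Fin k} {B : Matrix (Fin k) (Fin k) ℝ}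
  {A V : Matrix (Fin n) (Fin n) ℝ} {d : Fin n → ℝ} {f : Fin k ↪ Fin n} {η : ℝ}

/-- The eigenvalues of `A` outside the `k` leading ones are at most the operator norm of
`A - blockMatrix c B`: the kernel of the block matrix meets the span of the eigenvectors of any
`k + 1` eigenvalues of `A`. -/
lemma sq_eigenvalue_le_of_not_leading (hV : Vᵀ * V = 1) (hA : A = V * diagonal d * Vᵀ)
    (hf : ∀ a, ∀ b ∉ Set.range f, |d b| ≤ |d (f a)|)
    (hη : ∀ x, ((A - blockMatrix c B) *ᵥ x) ⬝ᵥ ((A - blockMatrix c B) *ᵥ x) ≤ η * (x ⬝ᵥ x))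
    {b : Fin n} (hb : b ∉ Set.range f) : d b ^ 2 ≤ η := by
  let h : Option (Fin k) → Fin n := fun o => o.elim b f
  have hinj : Function.Injective h := by
    rintro (_ | a) (_ | a') heq
    · rfl
    · exact absurd ⟨a', heq.symm⟩ hb
    · exact absurd ⟨a, heq⟩ hb
    · exact congrArg some (f.injective heq)
  have hdb : ∀ o, d b ^ 2 ≤ d (h o) ^ 2 := by
    rintro (_ | a)
    · exact le_rfl
    · exact sq_le_sq.2 (hf a b hb)
  let S : Matrix (Fin n) (Option (Fin k)) ℝ := Matrix.of fun j o => if h o = j then 1 else 0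
  have hS : ∀ g o, (S *ᵥ g) (h o) = g o := fun g o => by
    simp only [S, mulVec, dotProduct, of_apply, ite_mul, one_mul, zero_mul]
    rw [Finset.sum_eq_single o] <;> simp +contextual [hinj.eq_iff]
  have hS0 : ∀ g j, (S *ᵥ g) j ≠ 0 → ∃ o, h o = j := fun g j hj => by
    by_contra! hcon
    exact hj (by simp [S, mulVec, dotProduct, hcon])
  have hker : LinearMap.ker ((assignment c)ᵀ * V * S).mulVecLin ≠ ⊥ :=
    LinearMap.ker_ne_bot_of_finrank_lt (by simp)
  obtain ⟨g, hg, hg0⟩ := Submodule.exists_mem_ne_zero_of_ne_bot hker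
  set q := S *ᵥ g with hq
  have hq0 : 0 < q ⬝ᵥ q := by
    refine lt_of_le_of_ne (dotProduct_self_nonneg_real q) fun h0 => hg0 ?_
    have := dotProduct_self_eq_zero.1 h0.symm
    ext o
    rw [← hS g o, ← hq, this]
    rfl
  have hP : blockMatrix c B *ᵥ (V *ᵥ q) = 0 := by
    rw [LinearMap.mem_ker, mulVecLin_apply, ← mulVec_mulVec, ← mulVec_mulVec, ← hq] at hg
    rw [blockMatrix_eq, ← mulVec_mulVec, hg, mulVec_zero]
  have hle := hη (V *ᵥ q)
  have hAV : A *ᵥ (V *ᵥ q) = V *ᵥ (diagonal d *ᵥ q) := by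
    rw [hA, ← mulVec_mulVec, ← mulVec_mulVec, mulVec_mulVec _ Vᵀ, hV, one_mulVec]
  rw [sub_mulVec, hP, sub_zero, hAV, mulVec_dotProduct_mulVec_of_transpose_mul_self hV,
    mulVec_dotProduct_mulVec_of_transpose_mul_self hV] at hle
  refine le_of_mul_le_mul_right (le_trans ?_ hle) hq0
  rw [dotProduct_self_eq_sum_sq, dotProduct_self_eq_sum_sq, Finset.mul_sum]
  refine Finset.sum_le_sum fun j _ => ?_
  rw [mulVec_diagonal, mul_pow]
  by_cases hj : q j = 0
  · simp [hj]
  · obtain ⟨o, rfl⟩ := hS0 g j hj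
    exact mul_le_mul_of_nonneg_right (hdb o) (sq_nonneg _)

/-- A sine-theta bound: a block-constant vector is almost in the span of the leading eigenvectors
`U` of `A`. -/
lemma sin_theta_bound (hB : B.IsSymm) (hrank : (blockMatrix c B).rank = k)
    {U : Matrix (Fin n) (Fin k) ℝ} (hU : IsLeadingEigenvectors A U)
    (hη : ∀ x, ((A - blockMatrix c B) *ᵥ x) ⬝ᵥ ((A - blockMatrix c B) *ᵥ x) ≤ η * (x ⬝ᵥ x))
    (hη0 : 0 ≤ η) (v : Fin k → ℝ) :
    lambdaMin (blockMatrix c B) ^ 2 * ((fun i => v (c i)) ⬝ᵥ (fun i => v (c i)) -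
      (Uᵀ *ᵥ fun i => v (c i)) ⬝ᵥ (Uᵀ *ᵥ fun i => v (c i))) ≤
        4 * η * ((fun i => v (c i)) ⬝ᵥ (fun i => v (c i))) := by
  obtain ⟨V, d, f, hV, hAV, hf, hUV⟩ := hU
  have hV1 : Vᵀ * V = 1 := (mem_orthogonalGroup_iff' _ _).1 hV
  have hV2 : V * Vᵀ = 1 := (mem_orthogonalGroup_iff _ _).1 hV
  have hV2' : Vᵀᵀ * Vᵀ = 1 := by rwa [transpose_transpose]
  have hA : A = V * diagonal d * Vᵀ := by rw [← hAV, Matrix.mul_assoc, hV2, Matrix.mul_one]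
  have hPs : (blockMatrix c B).IsSymm := by
    ext i j
    exact hB.apply _ _
  set x : Fin n → ℝ := fun i => v (c i) with hx
  obtain ⟨u, hu⟩ : ∃ u, blockMatrix c B *ᵥ u = x := by
    have : x ∈ LinearMap.range (assignment c).mulVecLin :=
      ⟨v, by ext i; rw [mulVecLin_apply, assignment_mulVec]⟩
    rw [← range_blockMatrix_eq hrank] at this
    exact this
  obtain ⟨y, hy, hyl⟩ := exists_mulVec_eq_of_mem_range hPs u
  rw [hu] at hy hyl
  have hsplit : x ⬝ᵥ x - (Uᵀ *ᵥ x) ⬝ᵥ (Uᵀ *ᵥ x) =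
      ∑ b with b ∉ Set.range f, (Vᵀ *ᵥ x) b ^ 2 := by
    rw [← mulVec_dotProduct_mulVec_of_transpose_mul_self hV2' x, dotProduct_self_eq_sum_sq,
      dotProduct_self_eq_sum_sq, sub_eq_iff_eq_add,
      ← Finset.sum_filter_not_add_sum_filter Finset.univ (fun b => b ∈ Set.range f)]
    congr 1
    have hU' : ∀ a, (Uᵀ *ᵥ x) a = (Vᵀ *ᵥ x) (f a) := fun a => by
      simp [mulVec, dotProduct, hUV]
    simp only [hU']
    rw [← Finset.sum_map Finset.univ f (fun b => (Vᵀ *ᵥ x) b ^ 2)]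
    congr 1
    ext b
    simp
  have hVx : Vᵀ *ᵥ x = fun b => d b * (Vᵀ *ᵥ y) b - (Vᵀ *ᵥ ((A - blockMatrix c B) *ᵥ y)) b := by
    ext b
    rw [← transpose_mulVec_mulVec_of_diagonalized hV1 hA, sub_mulVec, mulVec_sub, hy,
      Pi.sub_apply, sub_sub_cancel]
  have hbound : ∑ b with b ∉ Set.range f, (Vᵀ *ᵥ x) b ^ 2 ≤ 4 * η * (y ⬝ᵥ y) := by
    calc ∑ b with b ∉ Set.range f, (Vᵀ *ᵥ x) b ^ 2
        ≤ ∑ b with b ∉ Set.range f, (2 * (η * (Vᵀ *ᵥ y) b ^ 2) +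
            2 * (Vᵀ *ᵥ ((A - blockMatrix c B) *ᵥ y)) b ^ 2) := by
          refine Finset.sum_le_sum fun b hb => ?_
          have h1 := mul_le_mul_of_nonneg_right (sq_eigenvalue_le_of_not_leading hV1 hA hf hη
            (Finset.mem_filter.1 hb).2) (sq_nonneg ((Vᵀ *ᵥ y) b))
          rw [hVx]
          nlinarith [sq_nonneg (d b * (Vᵀ *ᵥ y) b + (Vᵀ *ᵥ ((A - blockMatrix c B) *ᵥ y)) b)]
      _ ≤ ∑ b, (2 * (η * (Vᵀ *ᵥ y) b ^ 2) +
            2 * (Vᵀ *ᵥ ((A - blockMatrix c B) *ᵥ y)) b ^ 2) :=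
          Finset.sum_le_sum_of_subset_of_nonneg (Finset.filter_subset _ _)
            fun b _ _ => by positivity
      _ = 2 * (η * (y ⬝ᵥ y)) + 2 * (((A - blockMatrix c B) *ᵥ y) ⬝ᵥ
            ((A - blockMatrix c B) *ᵥ y)) := by
          rw [Finset.sum_add_distrib, ← Finset.mul_sum, ← Finset.mul_sum, ← Finset.mul_sum,
            ← dotProduct_self_eq_sum_sq, ← dotProduct_self_eq_sum_sq,
            mulVec_dotProduct_mulVec_of_transpose_mul_self hV2',
            mulVec_dotProduct_mulVec_of_transpose_mul_self hV2']
      _ ≤ 4 * η * (y ⬝ᵥ y) := by linarith [hη y]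
  rw [hsplit]
  calc _ ≤ lambdaMin (blockMatrix c B) ^ 2 * (4 * η * (y ⬝ᵥ y)) := by gcongr
    _ = 4 * η * (lambdaMin (blockMatrix c B) ^ 2 * (y ⬝ᵥ y)) := by ring
    _ ≤ _ := by gcongr

lemma sum_sq_leadingEigenvectors {U : Matrix (Fin n) (Fin k) ℝ}
    (hU : IsLeadingEigenvectors A U) : ∑ i, ∑ l, U i l ^ 2 = k := by
  obtain ⟨V, d, f, hV, -, -, hUV⟩ := hU
  have hV1 : Vᵀ * V = 1 := (mem_orthogonalGroup_iff' _ _).1 hV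
  rw [Finset.sum_comm]
  have : ∀ l, ∑ i, U i l ^ 2 = 1 := fun l => by
    have := congrFun (congrFun hV1 (f l)) (f l)
    simpa [Matrix.mul_apply, hUV, pow_two] using this
  simp [this]

/-- The mean of the rows of `U` over each block. -/
noncomputable def blockMean (c : Fin n → Fin k) (U : Matrix (Fin n) (Fin k) ℝ) :
    Matrix (Fin k) (Fin k) ℝ :=
  Matrix.of fun a l => (∑ i with c i = a, U i l) / blockSize c a

variable {U : Matrix (Fin n) (Fin k) ℝ}

lemma sum_comp_block (c : Fin n → Fin k) (g : Fin k → ℝ) :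
    ∑ i, g (c i) = ∑ a, blockSize c a * g a := by
  rw [← Finset.sum_fiberwise Finset.univ c]
  refine Finset.sum_congr rfl fun a _ => ?_
  rw [Finset.sum_congr rfl (g := fun _ => g a) (fun i hi => by rw [(Finset.mem_filter.1 hi).2])]
  simp [blockSize]

lemma transpose_mulVec_block (hpos : ∀ a, 0 < blockSize c a) (v : Fin k → ℝ) :
    (Uᵀ *ᵥ fun i => v (c i)) = fun l => ∑ a, blockSize c a * v a * blockMean c U a l := by
  ext l
  simp only [mulVec, dotProduct, transpose_apply]
  rw [← Finset.sum_fiberwise Finset.univ c]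
  refine Finset.sum_congr rfl fun a _ => ?_
  have : (blockSize c a : ℝ) ≠ 0 := by exact_mod_cast (hpos a).ne'
  rw [blockMean, of_apply, Finset.sum_congr rfl (g := fun i => U i l * v a)
    (fun i hi => by rw [(Finset.mem_filter.1 hi).2]), ← Finset.sum_mul]
  field_simp

lemma kmeansCost_blockMean (hpos : ∀ a, 0 < blockSize c a) (hU : IsLeadingEigenvectors A U) :
    kmeansCost U c (blockMean c U) =
      ∑ a, (1 - blockSize c a * ∑ l, blockMean c U a l ^ 2) := by
  have h1 : ∀ i l, (U i l - blockMean c U (c i) l) ^ 2 = U i l ^ 2 -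
      2 * (U i l * blockMean c U (c i) l) + blockMean c U (c i) l ^ 2 := fun i l => by ring
  simp only [kmeansCost, h1, Finset.sum_add_distrib, Finset.sum_sub_distrib, ← Finset.mul_sum]
  rw [sum_sq_leadingEigenvectors hU, sum_comp_block c fun a => ∑ l, blockMean c U a l ^ 2]
  have h2 : ∑ i, ∑ l, U i l * blockMean c U (c i) l =
      ∑ a, blockSize c a * ∑ l, blockMean c U a l ^ 2 := by
    rw [← Finset.sum_fiberwise Finset.univ c]
    refine Finset.sum_congr rfl fun a _ => ?_
    rw [Finset.sum_congr rfl (g := fun i => ∑ l, U i l * blockMean c U a l)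
      (fun i hi => by rw [(Finset.mem_filter.1 hi).2]), Finset.sum_comm, Finset.mul_sum]
    refine Finset.sum_congr rfl fun l _ => ?_
    have : (blockSize c a : ℝ) ≠ 0 := by exact_mod_cast (hpos a).ne'
    rw [← Finset.sum_mul, blockMean, of_apply]
    field_simp
  rw [h2]
  simp
  ring

/-- The rows of the leading eigenvectors are close to their block means. -/
lemma kmeansCost_blockMean_le (hB : B.IsSymm) (hrank : (blockMatrix c B).rank = k)
    (hU : IsLeadingEigenvectors A U)
    (hη : ∀ x, ((A - blockMatrix c B) *ᵥ x) ⬝ᵥ ((A - blockMatrix c B) *ᵥ x) ≤ η * (x ⬝ᵥ x))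
    (hη0 : 0 ≤ η) :
    lambdaMin (blockMatrix c B) ^ 2 * kmeansCost U c (blockMean c U) ≤ 4 * k * η := by
  have hpos := blockSize_pos hrank
  rw [kmeansCost_blockMean hpos hU, Finset.mul_sum]
  have : (4 * k * η : ℝ) = ∑ _a : Fin k, 4 * η := by simp; ring
  rw [this]
  refine Finset.sum_le_sum fun a _ => ?_
  have h := sin_theta_bound hB hrank hU hη hη0 (Pi.single a 1)
  rw [transpose_mulVec_block hpos, dotProduct_self_eq_sum_sq, dotProduct_self_eq_sum_sq,
    sum_comp_block c (fun b => (Pi.single a (1 : ℝ) : Fin k → ℝ) b ^ 2)] at h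
  simp only [Pi.single_apply, ite_pow, one_pow, mul_ite, mul_one, mul_zero, ite_mul, zero_mul,
    Finset.sum_ite_eq', Finset.mem_univ, if_true, ne_eq, OfNat.ofNat_ne_zero, not_false_eq_true,
    zero_pow, mul_pow, ← Finset.mul_sum] at h
  have hp : (0 : ℝ) < blockSize c a := by exact_mod_cast hpos a
  refine le_of_mul_le_mul_left ?_ hp
  linarith

/-- Different blocks have well separated means, if the perturbation is small. -/
lemma blockMean_separated (hB : B.IsSymm) (hrank : (blockMatrix c B).rank = k)
    (hU : IsLeadingEigenvectors A U)
    (hη : ∀ x, ((A - blockMatrix c B) *ᵥ x) ⬝ᵥ ((A - blockMatrix c B) *ᵥ x) ≤ η * (x ⬝ᵥ x))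
    (hη0 : 0 ≤ η) (hl : 0 < lambdaMin (blockMatrix c B))
    (hsmall : 8 * η ≤ lambdaMin (blockMatrix c B) ^ 2) {a b : Fin k} (hab : a ≠ b) :
    (1 / blockSize c a + 1 / blockSize c b : ℝ) / 2 ≤
      ∑ l, (blockMean c U a l - blockMean c U b l) ^ 2 := by
  have hpos := blockSize_pos hrank
  have ha : (0 : ℝ) < blockSize c a := by exact_mod_cast hpos a
  have hb : (0 : ℝ) < blockSize c b := by exact_mod_cast hpos b
  set v : Fin k → ℝ := Pi.single a (1 / blockSize c a : ℝ) - Pi.single b (1 / blockSize c b : ℝ)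
    with hv
  have h := sin_theta_bound hB hrank hU hη hη0 v
  have hx : (fun i => v (c i)) ⬝ᵥ (fun i => v (c i)) =
      1 / blockSize c a + 1 / blockSize c b := by
    rw [dotProduct_self_eq_sum_sq, sum_comp_block c (fun b => v b ^ 2)]
    have : ∀ e, (blockSize c e : ℝ) * v e ^ 2 =
        (if e = a then (1 / blockSize c a : ℝ) else 0) +
          if e = b then (1 / blockSize c b : ℝ) else 0 := fun e => by
      by_cases h1 : e = a
      · subst h1; simp [hv, hab]; field_simp
      · by_cases h2 : e = b
        · subst h2; simp [hv, h1]; field_simp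
        · simp [hv, h1, h2]
    simp [this, Finset.sum_add_distrib]
  have hy : (Uᵀ *ᵥ fun i => v (c i)) = fun l => blockMean c U a l - blockMean c U b l := by
    rw [transpose_mulVec_block hpos]
    ext l
    have : ∀ e, (blockSize c e : ℝ) * v e * blockMean c U e l =
        (if e = a then blockMean c U a l else 0) -
          if e = b then blockMean c U b l else 0 := fun e => by
      by_cases h1 : e = a
      · subst h1; simp [hv, hab]; field_simp
      · by_cases h2 : e = b
        · subst h2; simp [hv, h1]; field_simp
        · simp [hv, h1, h2]
    simp [this, Finset.sum_sub_distrib]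
  rw [hx, hy, dotProduct_self_eq_sum_sq] at h
  have hs : (0 : ℝ) < 1 / blockSize c a + 1 / blockSize c b := by positivity
  have hl2 : 0 < lambdaMin (blockMatrix c B) ^ 2 := by positivity
  refine le_of_mul_le_mul_left ?_ hl2
  nlinarith [mul_le_mul_of_nonneg_right hsmall hs.le]

end Perturbation

/-! ### From separated centers to the misclustering rate -/

section Misclustering

variable {n k : ℕ} {c z : Fin n → Fin k}

/-- If nodes of different blocks outside of an exceptional set `S` have different labels, then the
labels agree with the blocks after a permutation, up to a number of nodes that is controlled by the
weight of `S`, where a node weighs the reciprocal of the size of its block. A block inside `S` frees a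
label, so that another block may be split between several labels; there are at most as many split
blocks as blocks inside `S`, which accounts for the factor `2`. -/
lemma exists_perm_card_misclustered_le (hpos : ∀ a, 0 < blockSize c a) (S : Finset (Fin n))
    (hsep : ∀ i ∉ S, ∀ j ∉ S, c i ≠ c j → z i ≠ z j) :
    ∃ π : Equiv.Perm (Fin k), ((Finset.univ.filter fun i : Fin n => c i ≠ π (z i)).card : ℝ) ≤
      2 * maxBlockSize c * ∑ i ∈ S, (1 / blockSize c (c i) : ℝ) := by
  classical
  set G : Finset (Fin k) := Finset.univ.filter fun a => ∃ i, i ∉ S ∧ c i = a with hG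
  have hrep : ∀ a, ∃ i : Fin n, c i = a ∧ (a ∈ G → i ∉ S) := fun a => by
    by_cases ha : a ∈ G
    · obtain ⟨i, hi, hia⟩ := (Finset.mem_filter.1 ha).2
      exact ⟨i, hia, fun _ => hi⟩
    · obtain ⟨i, hi⟩ := Finset.card_pos.1 (hpos a)
      exact ⟨i, (Finset.mem_filter.1 hi).2, fun h => absurd h ha⟩
  choose rep hrep_c hrep_S using hrep
  have hinj : Set.InjOn (fun a => z (rep a)) (G : Set (Fin k)) := fun a ha b hb hab => by
    by_contra hne
    exact hsep _ (hrep_S a ha) _ (hrep_S b hb) (by rwa [hrep_c, hrep_c]) hab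
  obtain ⟨σ, hσ⟩ := Finset.exists_equiv_extend_of_card_eq (t := (Finset.univ : Finset (Fin k)))
    (by simp) (Finset.subset_univ _) hinj
  let σ' : Equiv.Perm (Fin k) := σ.trans (Equiv.subtypeUnivEquiv (fun x => Finset.mem_univ x))
  have hσ' : ∀ a ∈ G, σ' a = z (rep a) := fun a ha => hσ a ha
  set D : Finset (Fin k) := G.filter fun a => ∃ i, i ∉ S ∧ c i = a ∧ z i ≠ z (rep a) with hD
  have hsub : (Finset.univ.filter fun i : Fin n => c i ≠ σ'.symm (z i)) ⊆
      S ∪ D.biUnion fun a => Finset.univ.filter fun i => c i = a := by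
    intro i hi
    by_cases hiS : i ∈ S
    · exact Finset.mem_union_left _ hiS
    · have hiG : c i ∈ G := Finset.mem_filter.2 ⟨Finset.mem_univ _, i, hiS, rfl⟩
      refine Finset.mem_union_right _ (Finset.mem_biUnion.2 ⟨c i, Finset.mem_filter.2
        ⟨hiG, i, hiS, rfl, fun h => (Finset.mem_filter.1 hi).2 ?_⟩, by simp⟩)
      rw [h, ← hσ' _ hiG, Equiv.symm_apply_apply]
  -- the second labels of the split blocks and the first labels of all blocks are distinct
  have hDcard : D.card ≤ Gᶜ.card := by
    have hex : ∀ a, ∃ i : Fin n, a ∈ D → i ∉ S ∧ c i = a ∧ z i ≠ z (rep a) := fun a => by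
      by_cases ha : a ∈ D
      · obtain ⟨i, hi⟩ := (Finset.mem_filter.1 ha).2
        exact ⟨i, fun _ => hi⟩
      · exact ⟨rep a, fun h => absurd h ha⟩
    choose alt halt using hex
    have hinj2 : Set.InjOn (fun a => z (alt a)) (D : Set (Fin k)) := fun a ha b hb hab => by
      by_contra hne
      obtain ⟨h1, h2, -⟩ := halt a ha
      obtain ⟨h3, h4, -⟩ := halt b hb
      exact hsep _ h1 _ h3 (by rwa [h2, h4]) hab
    have hdisj : Disjoint (G.image fun a => z (rep a)) (D.image fun a => z (alt a)) := by
      rw [Finset.disjoint_left]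
      intro l hl hl'
      obtain ⟨a, ha, rfl⟩ := Finset.mem_image.1 hl
      obtain ⟨b, hb, hbl⟩ := Finset.mem_image.1 hl'
      obtain ⟨h1, h2, h3⟩ := halt b hb
      by_cases hab : a = b
      · exact h3 (hab ▸ hbl)
      · exact hsep _ h1 _ (hrep_S a ha) (by rw [h2, hrep_c]; exact Ne.symm hab) hbl
    have hle := Finset.card_le_univ ((G.image fun a => z (rep a)) ∪ (D.image fun a => z (alt a)))
    rw [Finset.card_union_of_disjoint hdisj, Finset.card_image_of_injOn hinj,
      Finset.card_image_of_injOn hinj2] at hle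
    rw [Finset.card_compl]
    omega
  have hM : ∀ a, (1 : ℝ) ≤ maxBlockSize c * (1 / blockSize c a) := fun a => by
    have h1 : (0 : ℝ) < blockSize c a := by exact_mod_cast hpos a
    rw [mul_one_div, le_div_iff₀ h1, one_mul]
    exact_mod_cast blockSize_le c a
  have hS1 : (S.card : ℝ) ≤ maxBlockSize c * ∑ i ∈ S, (1 / blockSize c (c i) : ℝ) := by
    rw [Finset.mul_sum, Finset.card_eq_sum_ones, Nat.cast_sum, Nat.cast_one]
    exact Finset.sum_le_sum fun i _ => hM _
  have hS2 : (Gᶜ.card : ℝ) ≤ ∑ i ∈ S, (1 / blockSize c (c i) : ℝ) := by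
    have hfib : ∀ a ∈ Gᶜ, ∑ i with c i = a, (1 / blockSize c (c i) : ℝ) = 1 := fun a _ => by
      have h1 : (blockSize c a : ℝ) ≠ 0 := by exact_mod_cast (hpos a).ne'
      rw [Finset.sum_congr rfl (g := fun _ => (1 / blockSize c a : ℝ))
        (fun i hi => by rw [(Finset.mem_filter.1 hi).2])]
      rw [Finset.sum_const, nsmul_eq_mul, mul_one_div]
      exact div_self h1
    calc (Gᶜ.card : ℝ) = ∑ a ∈ Gᶜ, ∑ i with c i = a, (1 / blockSize c (c i) : ℝ) := by
          rw [Finset.sum_congr rfl hfib]; simp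
      _ = ∑ i ∈ Gᶜ.biUnion fun a => Finset.univ.filter fun i => c i = a,
            (1 / blockSize c (c i) : ℝ) := by
          rw [Finset.sum_biUnion]
          intro a _ b _ hab
          refine Finset.disjoint_left.2 fun i hi hi' => hab ?_
          rw [← (Finset.mem_filter.1 hi).2, (Finset.mem_filter.1 hi').2]
      _ ≤ ∑ i ∈ S, (1 / blockSize c (c i) : ℝ) := by
          refine Finset.sum_le_sum_of_subset_of_nonneg (fun i hi => ?_) fun _ _ _ => by positivity
          obtain ⟨a, ha, hia⟩ := Finset.mem_biUnion.1 hi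
          by_contra hiS
          exact Finset.mem_compl.1 ha
            (Finset.mem_filter.2 ⟨Finset.mem_univ _, i, hiS, (Finset.mem_filter.1 hia).2⟩)
  have hU : (D.biUnion fun a => Finset.univ.filter fun i => c i = a).card ≤
      D.card * maxBlockSize c :=
    Finset.card_biUnion_le_card_mul _ _ _ fun a _ => blockSize_le c a
  refine ⟨σ'.symm, ?_⟩
  calc ((Finset.univ.filter fun i : Fin n => c i ≠ σ'.symm (z i)).card : ℝ)
      ≤ (S.card : ℝ) + (Gᶜ.card : ℝ) * maxBlockSize c := by
        have := (Finset.card_le_card hsub).trans (Finset.card_union_le _ _)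
        have := this.trans (Nat.add_le_add_left (hU.trans (Nat.mul_le_mul_right _ hDcard)) _)
        exact_mod_cast this
    _ ≤ maxBlockSize c * ∑ i ∈ S, (1 / blockSize c (c i) : ℝ) +
          (∑ i ∈ S, (1 / blockSize c (c i) : ℝ)) * maxBlockSize c := by gcongr
    _ = _ := by ring

lemma misclusteringRate_le (π : Equiv.Perm (Fin k)) : misclusteringRate c z ≤
    (1 / (n : ℝ)) * ((Finset.univ.filter fun i : Fin n => c i ≠ π (z i)).card : ℝ) :=
  ciInf_le (Set.finite_range _).bddBelow π

lemma misclusteringRate_le_one : misclusteringRate c z ≤ 1 := by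
  refine (misclusteringRate_le 1).trans ?_
  rcases Nat.eq_zero_or_pos n with rfl | hn
  · simp
  · have h : ((Finset.univ.filter fun i : Fin n =>
        c i ≠ (1 : Equiv.Perm (Fin k)) (z i)).card : ℝ) ≤ n := by
      exact_mod_cast (Finset.card_le_univ _).trans_eq (Fintype.card_fin n)
    have hn' : (0 : ℝ) < n := by exact_mod_cast hn
    rw [one_div, inv_mul_le_iff₀ hn', mul_one]
    exact h

/-- Spectral clustering of `A` recovers the blocks of a full rank block matrix up to a fraction of
nodes that is controlled by the operator norm of the difference. -/
theorem misclusteringRate_le_of_operator_norm {B : Matrix (Fin k) (Fin k) ℝ}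
    {A : Matrix (Fin n) (Fin n) ℝ} {η ε : ℝ} (hk : 1 ≤ k) (hB : B.IsSymm)
    (hrank : (blockMatrix c B).rank = k)
    (hη : ∀ x, ((A - blockMatrix c B) *ᵥ x) ⬝ᵥ ((A - blockMatrix c B) *ᵥ x) ≤ η * (x ⬝ᵥ x))
    (hη0 : 0 ≤ η) (hε : 0 < ε) (hz : IsSpectralClustering ε A z) :
    misclusteringRate c z ≤ 64 * (2 + ε) *
      ((maxBlockSize c : ℝ) * k * η / (n * lambdaMin (blockMatrix c B) ^ 2)) := by
  have hpos := blockSize_pos hrank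
  have hl : 0 < lambdaMin (blockMatrix c B) := by
    refine lambdaMin_pos (by ext i j; exact hB.apply _ _) fun h0 => ?_
    rw [h0, rank_zero] at hrank
    omega
  set L := lambdaMin (blockMatrix c B) with hL
  have hn : 0 < n := by
    rcases Nat.eq_zero_or_pos n with h | h
    · have := sum_blockSize c
      have h2 := Finset.single_le_sum (f := fun a => blockSize c a) (fun _ _ => Nat.zero_le _)
        (Finset.mem_univ (⟨0, hk⟩ : Fin k))
      have h3 := hpos ⟨0, hk⟩
      omega
    · exact h
  have hn' : (0 : ℝ) < n := by exact_mod_cast hn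
  by_cases hsmall : 8 * η ≤ L ^ 2
  swap
  · -- the bound exceeds `1`, because `k` blocks of the largest size cover all nodes
    refine misclusteringRate_le_one.trans ?_
    have hcover : (n : ℝ) ≤ maxBlockSize c * k := by
      have := Finset.sum_le_card_nsmul Finset.univ (blockSize c) (maxBlockSize c)
        fun a _ => blockSize_le c a
      rw [sum_blockSize] at this
      have h2 : n ≤ maxBlockSize c * k := by simpa [mul_comm] using this
      exact_mod_cast h2
    rw [← mul_div_assoc, le_div_iff₀ (by positivity), one_mul]
    push Not at hsmall
    calc (n : ℝ) * L ^ 2 ≤ (maxBlockSize c * k) * (8 * η) := by gcongr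
      _ ≤ 64 * (2 + ε) * (maxBlockSize c * k * η) := by
        have : 0 ≤ (maxBlockSize c : ℝ) * k * η := by positivity
        nlinarith
  obtain ⟨U, hU, X, hX⟩ := hz
  set Y := blockMean c U with hY
  have hcost := kmeansCost_blockMean_le hB hrank hU hη hη0
  set dist : Fin n → ℝ := fun i => ∑ l, (X (z i) l - Y (c i) l) ^ 2 with hdist
  set S : Finset (Fin n) := Finset.univ.filter fun i => (1 / blockSize c (c i) : ℝ) / 4 ≤ dist i
    with hS
  have hsep : ∀ i ∉ S, ∀ j ∉ S, c i ≠ c j → z i ≠ z j := by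
    intro i hi j hj hij hzz
    have hi' : dist i < (1 / blockSize c (c i) : ℝ) / 4 := by simpa [hS] using hi
    have hj' : dist j < (1 / blockSize c (c j) : ℝ) / 4 := by simpa [hS] using hj
    have h := blockMean_separated hB hrank hU hη hη0 hl hsmall hij
    have h2 : ∑ l, (Y (c i) l - Y (c j) l) ^ 2 ≤ 2 * dist i + 2 * dist j := by
      simp only [hdist, Finset.mul_sum, ← Finset.sum_add_distrib, hzz]
      exact Finset.sum_le_sum fun l _ => by
        nlinarith [sq_nonneg (Y (c i) l + Y (c j) l - 2 * X (z j) l)]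
    linarith
  have hdsum : ∑ i, dist i ≤ 2 * (2 + ε) * kmeansCost U c Y := by
    have h1 : ∑ i, dist i ≤ 2 * kmeansCost U z X + 2 * kmeansCost U c Y := by
      simp only [hdist, kmeansCost, Finset.mul_sum, ← Finset.sum_add_distrib]
      exact Finset.sum_le_sum fun i _ => Finset.sum_le_sum fun l _ => by
        nlinarith [sq_nonneg (X (z i) l + Y (c i) l - 2 * U i l)]
    linarith [hX c Y]
  have hweight : ∑ i ∈ S, (1 / blockSize c (c i) : ℝ) ≤ 4 * ∑ i, dist i := by
    rw [Finset.mul_sum]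
    calc _ ≤ ∑ i ∈ S, 4 * dist i := Finset.sum_le_sum fun i hi => by
            linarith [(Finset.mem_filter.1 hi).2]
      _ ≤ _ := Finset.sum_le_sum_of_subset_of_nonneg (Finset.subset_univ _) fun i _ _ => by
            simp only [hdist]; positivity
  obtain ⟨π, hπ⟩ := exists_perm_card_misclustered_le hpos S hsep
  refine (misclusteringRate_le π).trans ?_
  have hL2 : 0 < L ^ 2 := by positivity
  have hcost' : kmeansCost U c Y ≤ 4 * k * η / L ^ 2 := by
    rw [le_div_iff₀ hL2]; linarith
  calc _ ≤ (1 / (n : ℝ)) * (2 * maxBlockSize c *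
        (4 * (2 * (2 + ε) * (4 * k * η / L ^ 2)))) := by
        gcongr
        refine hπ.trans ?_
        gcongr
        refine hweight.trans ?_
        gcongr
        refine hdsum.trans ?_
        gcongr
    _ = _ := by field_simp; ring

end Misclustering

/-! ### Closed walks -/

section Walks

variable {V W : Type*} {N : ℕ}

/-- The unordered pair traversed by the step `s` of a walk `w`, which may be a loop. -/
def walkEdge (w : Fin (N + 1) → V) (s : Fin N) : Sym2 V := s(w s.castSucc, w s.succ)

/-- A walk is paired if it is closed and traverses each of its edges at least twice. -/
def IsPaired (w : Fin (N + 1) → V) : Prop :=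
  w 0 = w (Fin.last N) ∧ ∀ s, ∃ s', s' ≠ s ∧ walkEdge w s' = walkEdge w s

/-- The symmetric matrix with the entry `f s(i, j)` in position `i`, `j`. -/
def symMatrix (f : Sym2 V → ℝ) : Matrix V V ℝ := Matrix.of fun i j => f s(i, j)

lemma symMatrix_isSymm (f : Sym2 V → ℝ) : (symMatrix f).IsSymm := by
  ext i j
  simp [symMatrix, Sym2.eq_swap]

open Classical in
/-- The number of distinct edges of a walk. -/
noncomputable def numEdges (w : Fin (N + 1) → V) : ℕ := (Finset.univ.image (walkEdge w)).card

open Classical in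
/-- The number of distinct vertices of a walk. -/
noncomputable def numVertices (w : Fin (N + 1) → V) : ℕ := (Finset.univ.image w).card

lemma numVertices_le (w : Fin (N + 1) → V) : numVertices w ≤ numEdges w + 1 := by
  classical
  induction N with
  | zero =>
    have : numVertices w = 1 := by simp [numVertices]
    omega
  | succ N ih =>
    set w' : Fin (N + 1) → V := fun i => w i.castSucc with hw'
    have hedge : ∀ s : Fin N, walkEdge w s.castSucc = walkEdge w' s := fun s => rfl
    have hv : Finset.univ.image w = insert (w (Fin.last _)) (Finset.univ.image w') := by
      ext x
      simp only [Finset.mem_image, Finset.mem_univ, true_and, Finset.mem_insert]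
      constructor
      · rintro ⟨i, rfl⟩
        refine Fin.lastCases (Or.inl rfl) (fun j => Or.inr ⟨j, rfl⟩) i
      · rintro (rfl | ⟨j, rfl⟩)
        · exact ⟨_, rfl⟩
        · exact ⟨_, rfl⟩
    have he : Finset.univ.image (walkEdge w) =
        insert (walkEdge w (Fin.last _)) (Finset.univ.image (walkEdge w')) := by
      ext x
      simp only [Finset.mem_image, Finset.mem_univ, true_and, Finset.mem_insert]
      constructor
      · rintro ⟨i, rfl⟩
        refine Fin.lastCases (Or.inl rfl) (fun j => Or.inr ⟨j, rfl⟩) i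
      · rintro (rfl | ⟨j, rfl⟩)
        · exact ⟨_, rfl⟩
        · exact ⟨_, rfl⟩
    have ih' := ih w'
    simp only [numVertices, numEdges] at ih' ⊢
    rw [hv, he]
    by_cases h : w (Fin.last _) ∈ Finset.univ.image w'
    · rw [Finset.insert_eq_of_mem h]
      exact ih'.trans (Nat.add_le_add_right (Finset.card_le_card (Finset.subset_insert _ _)) _)
    · -- a step to a new vertex uses a new edge
      have h' : walkEdge w (Fin.last _) ∉ Finset.univ.image (walkEdge w') := by
        intro hmem
        obtain ⟨s, -, hs⟩ := Finset.mem_image.1 hmem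
        have : w (Fin.last _) ∈ walkEdge w' s := by
          rw [hs, walkEdge, Fin.succ_last]
          exact Sym2.mem_mk_right _ _
        rcases Sym2.mem_iff.1 this with h1 | h1
        · exact h (Finset.mem_image.2 ⟨_, Finset.mem_univ _, h1.symm⟩)
        · exact h (Finset.mem_image.2 ⟨_, Finset.mem_univ _, h1.symm⟩)
      rw [Finset.card_insert_of_notMem h, Finset.card_insert_of_notMem h']
      omega

lemma IsPaired.two_mul_numEdges_le {w : Fin (N + 1) → V} (hw : IsPaired w) :
    2 * numEdges w ≤ N := by
  classical
  have h := Finset.card_eq_sum_card_image (walkEdge w) Finset.univ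
  rw [Finset.card_univ, Fintype.card_fin] at h
  refine le_trans ?_ h.symm.le
  rw [numEdges, mul_comm, ← smul_eq_mul]
  refine Finset.card_nsmul_le_sum _ _ _ fun e he => ?_
  obtain ⟨s, -, rfl⟩ := Finset.mem_image.1 he
  obtain ⟨s', hne, hs'⟩ := hw.2 s
  rw [← Finset.card_pair hne]
  refine Finset.card_le_card fun x hx => ?_
  rcases Finset.mem_insert.1 hx with rfl | hx
  · simpa using hs'
  · rw [Finset.mem_singleton.1 hx]; simp

section Kernel

variable {w : Fin (N + 1) → V} {w' : Fin (N + 1) → W}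

lemma walkEdge_eq_iff (h : ∀ i j, w i = w j ↔ w' i = w' j) (s s' : Fin N) :
    walkEdge w s = walkEdge w s' ↔ walkEdge w' s = walkEdge w' s' := by
  simp only [walkEdge, Sym2.eq_iff, h]

lemma isPaired_iff (h : ∀ i j, w i = w j ↔ w' i = w' j) : IsPaired w ↔ IsPaired w' := by
  simp only [IsPaired, h, walkEdge_eq_iff h]

lemma card_image_le_of_factor {ι α β : Type*} [Fintype ι] [DecidableEq α] [DecidableEq β]
    {f : ι → α} {g : ι → β} (h : ∀ i j, g i = g j → f i = f j) :
    (Finset.univ.image f).card ≤ (Finset.univ.image g).card := by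
  rcases isEmpty_or_nonempty ι with hι | hι
  · simp
  · have hfac : Function.FactorsThrough f g := fun i j hij => h i j hij
    obtain ⟨i⟩ := hι
    have : Nonempty α := ⟨f i⟩
    obtain ⟨e, rfl⟩ := (Function.factorsThrough_iff f).1 hfac
    rw [← Finset.image_image]
    exact Finset.card_image_le

lemma numEdges_eq (h : ∀ i j, w i = w j ↔ w' i = w' j) : numEdges w = numEdges w' := by
  classical
  exact le_antisymm (card_image_le_of_factor fun i j hij => (walkEdge_eq_iff h i j).2 hij)
    (card_image_le_of_factor fun i j hij => (walkEdge_eq_iff h i j).1 hij)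

open Classical in
/-- The number of walks in `W` with the same coincidences as a given walk. -/
lemma card_same_kernel [Fintype W] (w : Fin (N + 1) → V) :
    (Finset.univ.filter fun w' : Fin (N + 1) → W => ∀ i j, w' i = w' j ↔ w i = w j).card =
      (Fintype.card W).descFactorial (numVertices w) := by
  set S : Finset V := Finset.univ.image w with hS
  have hcard : Fintype.card S = numVertices w := Fintype.card_coe S
  rw [← hcard, ← Fintype.card_embedding_eq, ← Finset.card_univ]
  have hmem : ∀ i, w i ∈ S := fun i =>
    Finset.mem_image_of_mem _ (Finset.mem_univ i)
  symm
  refine Finset.card_bij (fun φ _ i => φ ⟨w i, hmem i⟩) ?_ ?_ ?_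
  · intro φ _
    simp
  · intro φ _ ψ _ h
    ext ⟨x, hx⟩
    obtain ⟨i, -, rfl⟩ := Finset.mem_image.1 hx
    exact congrFun h i
  · intro w' hw'
    have hk := (Finset.mem_filter.1 hw').2
    have hpre : ∀ x : S, ∃ i, w i = x := fun x => by
      obtain ⟨i, -, hi⟩ := Finset.mem_image.1 x.2
      exact ⟨i, hi⟩
    choose pre hpre using hpre
    refine ⟨⟨fun x => w' (pre x), fun x y hxy => ?_⟩, Finset.mem_univ _, ?_⟩
    · have := (hk _ _).1 hxy
      rw [hpre, hpre] at this
      exact Subtype.ext this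
    · ext i
      exact (hk _ _).2 (hpre _)

end Kernel

lemma descFactorial_comparison {n m v e : ℕ} {p : ℝ} (hp0 : 0 ≤ p) (hp1 : p ≤ 1)
    (hnp : n * p ≤ m) (hv : 1 ≤ v) (hve : v ≤ e + 1) (hem : 2 * e ≤ 2 * m) (hm : 1 ≤ m) :
    ((2 * m : ℕ) : ℝ) * (n.descFactorial v * p ^ e) ≤ n * (2 * m).descFactorial v := by
  obtain ⟨u, rfl⟩ : ∃ u, v = u + 1 := ⟨v - 1, by omega⟩
  obtain ⟨q, hq⟩ : ∃ q, 2 * m = q + 1 := ⟨2 * m - 1, by omega⟩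
  have h1 : (n.descFactorial (u + 1) : ℝ) ≤ n * (n : ℝ) ^ u := by
    have := Nat.descFactorial_le_pow n (u + 1)
    rw [pow_succ'] at this
    exact_mod_cast this
  have h2 : p ^ e ≤ p ^ u := pow_le_pow_of_le_one hp0 hp1 (by omega)
  have h3 : (m : ℝ) ^ u ≤ q.descFactorial u := by
    have := Nat.pow_sub_le_descFactorial q u
    have h4 : m ^ u ≤ (q + 1 - u) ^ u := Nat.pow_le_pow_left (by omega) u
    exact_mod_cast h4.trans this
  rw [hq, Nat.succ_descFactorial_succ]
  push_cast
  calc ((q : ℝ) + 1) * (n.descFactorial (u + 1) * p ^ e)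
      ≤ (q + 1) * (n * (n : ℝ) ^ u * p ^ u) := by gcongr
    _ = n * ((q + 1) * (n * p) ^ u) := by ring
    _ ≤ n * ((q + 1) * (m : ℝ) ^ u) := by gcongr
    _ ≤ n * ((q + 1) * q.descFactorial u) := by gcongr

open Classical in
/-- Comparison of the paired walks in a sparse random graph with those in a dense graph on `2m`
vertices: a pattern of `v` vertices and `e ≥ v - 1` edges has at most `n ^ v` embeddings, each of
weight `p ^ e`, while there are at least `2m * m ^ (v - 1)` embeddings into `2m` vertices. -/
lemma sum_paired_walks_le [Fintype V] {m : ℕ} {p : ℝ} (hp0 : 0 ≤ p) (hp1 : p ≤ 1)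
    (hnp : Fintype.card V * p ≤ m) (hm : 1 ≤ m) :
    ((2 * m : ℕ) : ℝ) * ∑ w : Fin (2 * m + 1) → V with IsPaired w, p ^ numEdges w ≤
      Fintype.card V *
        (Finset.univ.filter fun w : Fin (2 * m + 1) → Fin (2 * m) => IsPaired w).card := by
  let ker : ∀ {X : Type _}, (Fin (2 * m + 1) → X) → Fin (2 * m + 1) → Fin (2 * m + 1) → Prop :=
    fun w i j => w i = w j
  have hker : ∀ {w : Fin (2 * m + 1) → V} {K}, ker w = K → ∀ i j, w i = w j ↔ K i j := by
    rintro w _ rfl i j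
    rfl
  set ker' : (Fin (2 * m + 1) → Fin (2 * m)) → Fin (2 * m + 1) → Fin (2 * m + 1) → Prop :=
    fun w i j => w i = w j with hker'
  rw [← Finset.sum_fiberwise _ (ker (X := V)),
    Finset.card_eq_sum_card_fiberwise (f := ker') (t := Finset.univ) (fun _ _ => by simp),
    Nat.cast_sum, Finset.mul_sum, Finset.mul_sum]
  refine Finset.sum_le_sum fun K _ => ?_
  by_cases hK : ∃ w : Fin (2 * m + 1) → V, IsPaired w ∧ ker w = K
  swap
  · rw [Finset.sum_eq_zero]
    · rw [mul_zero]; positivity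
    · intro w hw
      simp only [Finset.mem_filter, Finset.mem_univ, true_and] at hw
      exact absurd ⟨w, hw⟩ hK
  obtain ⟨w₀, hw₀, rfl⟩ := hK
  have hsum : ∑ w ∈ (Finset.univ.filter fun w : Fin (2 * m + 1) → V => IsPaired w) with
      ker w = ker w₀, p ^ numEdges w =
        (Fintype.card V).descFactorial (numVertices w₀) * p ^ numEdges w₀ := by
    rw [← card_same_kernel w₀, ← nsmul_eq_mul, ← Finset.sum_const]
    refine Finset.sum_congr ?_ fun w hw => ?_
    · ext w
      simp only [Finset.mem_filter, Finset.mem_univ, true_and]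
      constructor
      · rintro ⟨-, h⟩ i j
        exact hker h i j
      · intro h
        exact ⟨(isPaired_iff h).2 hw₀, by ext i j; exact h i j⟩
    · rw [numEdges_eq (Finset.mem_filter.1 hw).2]
  have hcard : ((Finset.univ.filter fun w : Fin (2 * m + 1) → Fin (2 * m) =>
        IsPaired w).filter (fun w => ker' w = ker w₀)).card =
      (2 * m).descFactorial (numVertices w₀) := by
    have h := card_same_kernel (W := Fin (2 * m)) w₀
    rw [Fintype.card_fin] at h
    rw [← h]
    congr 1
    ext w
    simp only [Finset.mem_filter, Finset.mem_univ, true_and]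
    constructor
    · rintro ⟨-, h⟩ i j
      exact iff_of_eq (congrFun (congrFun h i) j)
    · intro h
      exact ⟨(isPaired_iff h).2 hw₀, by ext i j; exact h i j⟩
  rw [hsum, hcard]
  refine descFactorial_comparison hp0 hp1 hnp ?_ (numVertices_le _) hw₀.two_mul_numEdges_le hm
  exact Finset.card_pos.2 ⟨w₀ 0, Finset.mem_image_of_mem _ (Finset.mem_univ _)⟩

/-! ### Traces of powers as sums over closed walks -/

variable [DecidableEq V]

/-- The number of times that a walk traverses an edge. -/
def traversals (w : Fin (N + 1) → V) (e : Sym2 V) : ℕ :=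
  (Finset.univ.filter fun s => walkEdge w s = e).card

lemma traversals_pos_iff {w : Fin (N + 1) → V} {e : Sym2 V} :
    traversals w e ≠ 0 ↔ e ∈ Finset.univ.image (walkEdge w) := by
  rw [traversals, ← Nat.pos_iff_ne_zero, Finset.card_pos]
  simp [Finset.Nonempty]

lemma isPaired_iff_traversals {w : Fin (N + 1) → V} (h : w 0 = w (Fin.last N)) :
    IsPaired w ↔ ∀ e, traversals w e ≠ 1 := by
  constructor
  · intro hw e he
    obtain ⟨s, hs⟩ := Finset.card_eq_one.1 he
    have hse : walkEdge w s = e := by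
      have : s ∈ Finset.univ.filter fun s => walkEdge w s = e := by rw [hs]; simp
      exact (Finset.mem_filter.1 this).2
    obtain ⟨s', hne, hs'⟩ := hw.2 s
    have : s' ∈ Finset.univ.filter fun s => walkEdge w s = e := by simp [hs', hse]
    rw [hs] at this
    exact hne (Finset.mem_singleton.1 this)
  · intro ht
    refine ⟨h, fun s => ?_⟩
    by_contra! hcon
    refine ht (walkEdge w s) (Finset.card_eq_one.2 ⟨s, ?_⟩)
    ext s'
    simp only [Finset.mem_filter, Finset.mem_univ, true_and, Finset.mem_singleton]
    refine ⟨fun h' => ?_, fun h' => by rw [h']⟩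
    by_contra hne
    exact hcon s' hne h'

variable [Fintype V]

lemma symMatrix_pow_apply (f : Sym2 V → ℝ) (i j : V) :
    (symMatrix f ^ N) i j = ∑ w : Fin (N + 1) → V,
      if w 0 = i ∧ w (Fin.last N) = j then ∏ s, f (walkEdge w s) else 0 := by
  induction N generalizing i with
  | zero =>
    rw [← (Equiv.funUnique (Fin 1) V).symm.sum_comp]
    simp only [pow_zero, Matrix.one_apply, Finset.univ_eq_empty, Finset.prod_empty]
    by_cases hij : i = j
    · subst hij
      simp
    · rw [if_neg hij, Finset.sum_eq_zero]
      intro x _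
      rw [if_neg]
      rintro ⟨h1, h2⟩
      exact hij (h1.symm.trans h2)
  | succ N ih =>
    rw [pow_succ', Matrix.mul_apply, ← (Fin.consEquiv fun _ : Fin (N + 2) => V).sum_comp,
      Fintype.sum_prod_type]
    have hedge : ∀ (a : V) (w : Fin (N + 1) → V),
        ∏ s, f (walkEdge ((Fin.consEquiv fun _ : Fin (N + 2) => V) (a, w)) s) =
          f s(a, w 0) * ∏ s, f (walkEdge w s) := fun a w => by
      rw [Fin.prod_univ_succ]
      rfl
    have hlast : ∀ (a : V) (w : Fin (N + 1) → V),
        (Fin.cons a w : Fin (N + 2) → V) (Fin.last (N + 1)) = w (Fin.last N) := fun a w => rfl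
    simp only [hedge, ih, Finset.mul_sum]
    simp only [Fin.consEquiv_apply, Fin.cons_zero, hlast]
    rw [Finset.sum_comm, Finset.sum_comm (s := Finset.univ (α := V))]
    refine Finset.sum_congr rfl fun w _ => ?_
    rw [Finset.sum_eq_single (w 0), Finset.sum_eq_single i]
    · by_cases h : w (Fin.last N) = j <;> simp [h, symMatrix]
    · intro a _ ha
      simp [ha]
    · simp
    · intro a _ ha
      rw [if_neg fun h => ha h.1.symm, mul_zero]
    · simp

lemma trace_symMatrix_pow (f : Sym2 V → ℝ) :
    (symMatrix f ^ N).trace = ∑ w : Fin (N + 1) → V with w 0 = w (Fin.last N),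
      ∏ s, f (walkEdge w s) := by
  simp only [Matrix.trace, Matrix.diag, symMatrix_pow_apply]
  rw [Finset.sum_comm, Finset.sum_filter]
  refine Finset.sum_congr rfl fun w _ => ?_
  rw [Finset.sum_eq_single (w 0)]
  · simp [eq_comm]
  · intro a _ ha
    rw [if_neg fun h => ha h.1.symm]
  · simp

lemma prod_walkEdge (f : Sym2 V → ℝ) (w : Fin (N + 1) → V) :
    ∏ s, f (walkEdge w s) = ∏ e, f e ^ traversals w e := by
  rw [← Finset.prod_fiberwise Finset.univ (walkEdge w)]
  refine Finset.prod_congr rfl fun e _ => ?_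
  rw [Finset.prod_congr rfl (g := fun _ => f e)
    (fun s hs => by rw [(Finset.mem_filter.1 hs).2]), Finset.prod_const]
  rfl

end Walks

/-! ### Moments of sparse random matrices -/

section Moments

variable {V : Type*} [Fintype V] [DecidableEq V] {N : ℕ}

lemma prod_traversed (w : Fin (N + 1) → V) (p : ℝ) :
    ∏ e, (if traversals w e = 0 then 1 else p) = p ^ numEdges w := by
  rw [← Finset.prod_filter_mul_prod_filter_not Finset.univ (fun e => traversals w e = 0),
    Finset.prod_eq_one (fun e he => if_pos (Finset.mem_filter.1 he).2), one_mul,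
    Finset.prod_congr rfl (g := fun _ => p) (fun e he => if_neg (Finset.mem_filter.1 he).2),
    Finset.prod_const]
  congr 1
  rw [numEdges]
  congr 1
  ext e
  simp only [Finset.mem_filter, Finset.mem_univ, true_and, Finset.mem_image]
  rw [← ne_eq, traversals_pos_iff]
  simp

lemma integrable_prod_pow {ι Ω : Type*} [Fintype ι] [MeasurableSpace Ω] {P : Measure Ω}
    [IsFiniteMeasure P] {X : ι → Ω → ℝ} (hmeas : ∀ e, Measurable (X e))
    (hbd : ∀ e ω, |X e ω| ≤ 1) (t : ι → ℕ) : Integrable (fun ω => ∏ e, X e ω ^ t e) P := by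
  refine Integrable.of_bound (Finset.measurable_prod _ fun e _ =>
    (hmeas e).pow_const _).aestronglyMeasurable 1 (Filter.Eventually.of_forall fun ω => ?_)
  rw [Real.norm_eq_abs, Finset.abs_prod]
  refine Finset.prod_le_one (fun e _ => abs_nonneg (X e ω ^ t e)) fun e _ => ?_
  rw [abs_pow]
  exact pow_le_one₀ (abs_nonneg _) (hbd e ω)

lemma trace_symMatrix_pow_eq_sum_prod (f : Sym2 V → ℝ) (N : ℕ) :
    (symMatrix f ^ N).trace = ∑ w : Fin (N + 1) → V with w 0 = w (Fin.last N),
      ∏ e, f e ^ traversals w e := by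
  rw [trace_symMatrix_pow]
  exact Finset.sum_congr rfl fun w _ => prod_walkEdge f w

lemma integrable_trace_pow {Ω : Type*} [MeasurableSpace Ω] {P : Measure Ω} [IsFiniteMeasure P]
    {X : Sym2 V → Ω → ℝ} (hmeas : ∀ e, Measurable (X e)) (hbd : ∀ e ω, |X e ω| ≤ 1) (N : ℕ) :
    Integrable (fun ω => (symMatrix (fun e => X e ω) ^ N).trace) P := by
  simp only [trace_symMatrix_pow_eq_sum_prod]
  exact integrable_finsetSum _ fun w _ => integrable_prod_pow hmeas hbd _

open Classical in
/-- The moment method: only paired walks contribute to the expected trace of a power of a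
symmetric matrix with independent centered entries. Independence enters through the moments. -/
lemma integral_trace_pow_le {Ω : Type*} [MeasurableSpace Ω] {P : Measure Ω}
    [IsProbabilityMeasure P] {X : Sym2 V → Ω → ℝ} {p : ℝ}
    (hind : ∀ t : Sym2 V → ℕ, ∫ ω, ∏ e, X e ω ^ t e ∂P = ∏ e, ∫ ω, X e ω ^ t e ∂P)
    (hmeas : ∀ e, Measurable (X e)) (hbd : ∀ e ω, |X e ω| ≤ 1)
    (hmean : ∀ e, ∫ ω, X e ω ∂P = 0) (hvar : ∀ e, ∫ ω, X e ω ^ 2 ∂P ≤ p) (N : ℕ) :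
    ∫ ω, (symMatrix (fun e => X e ω) ^ N).trace ∂P ≤
      ∑ w : Fin (N + 1) → V with IsPaired w, p ^ numEdges w := by
  have hpow : ∀ (e : Sym2 V) (t : ℕ) ω, |X e ω ^ t| ≤ 1 := fun e t ω => by
    rw [abs_pow]
    exact pow_le_one₀ (abs_nonneg _) (hbd e ω)
  have hmom : ∀ (e : Sym2 V) (t : ℕ), t ≠ 1 →
      |∫ ω, X e ω ^ t ∂P| ≤ if t = 0 then 1 else p := by
    intro e t ht
    by_cases h0 : t = 0
    · simp [h0]
    · rw [if_neg h0]
      refine (abs_integral_le_integral_abs).trans ((integral_mono ?_ ?_ fun ω => ?_).trans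
        (hvar e))
      · exact Integrable.of_bound ((hmeas e).pow_const t).abs.aestronglyMeasurable 1
          (Filter.Eventually.of_forall fun ω => by simpa using hpow e t ω)
      · exact Integrable.of_bound ((hmeas e).pow_const 2).aestronglyMeasurable 1
          (Filter.Eventually.of_forall fun ω => by simpa using hpow e 2 ω)
      · simp only
        rw [abs_pow, ← sq_abs]
        exact pow_le_pow_of_le_one (abs_nonneg _) (hbd e ω) (by omega)
  simp only [trace_symMatrix_pow_eq_sum_prod]
  rw [integral_finsetSum]
  · have hfilter : (Finset.univ.filter fun w : Fin (N + 1) → V => IsPaired w) =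
        (Finset.univ.filter fun w : Fin (N + 1) → V => w 0 = w (Fin.last N)).filter
          fun w => IsPaired w := by
      rw [Finset.filter_filter]
      exact Finset.filter_congr fun w _ => ⟨fun h => ⟨h.1, h⟩, fun h => h.2⟩
    rw [hfilter, Finset.sum_filter (s := Finset.univ.filter _)]
    refine Finset.sum_le_sum fun w hw => ?_
    have hpair := isPaired_iff_traversals (Finset.mem_filter.1 hw).2
    rw [hind]
    by_cases hp : IsPaired w
    · rw [if_pos hp, ← prod_traversed]
      refine (le_abs_self _).trans ?_
      rw [Finset.abs_prod]
      exact Finset.prod_le_prod (fun e _ => abs_nonneg (∫ ω, X e ω ^ traversals w e ∂P))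
        fun e _ => hmom e _ (hpair.1 hp e)
    · rw [if_neg hp]
      rw [hpair] at hp
      push Not at hp
      obtain ⟨e, he⟩ := hp
      refine (Finset.prod_eq_zero (Finset.mem_univ e) ?_).le
      simp [he, hmean]
  · exact fun w _ => integrable_prod_pow hmeas hbd _

/-! ### A dense comparison matrix -/

/-- The values of a centered random variable, uniform on three points, all of whose moments of
order at least two are at least one. -/
def skewValue : Fin 3 → ℝ := ![2, -1, -1]

lemma sum_skewValue_pow (t : ℕ) : ∑ a, skewValue a ^ t = 2 ^ t + 2 * (-1) ^ t := by
  simp [Fin.sum_univ_three, skewValue]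
  ring

lemma sum_skewValue_pow_bounds (t : ℕ) :
    0 ≤ ∑ a, skewValue a ^ t ∧ (t ≠ 1 → 3 ≤ ∑ a, skewValue a ^ t) := by
  rw [sum_skewValue_pow]
  rcases t with _ | _ | _ | t
  · norm_num
  · norm_num
  · norm_num
  · have h1 : (1 : ℝ) ≤ 2 ^ t := one_le_pow₀ (by norm_num)
    have h2 : (8 : ℝ) ≤ 2 ^ (t + 1 + 1 + 1) := by
      rw [pow_succ, pow_succ, pow_succ]; linarith
    have h3 : (-1 : ℝ) ≤ (-1) ^ (t + 1 + 1 + 1) := by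
      rcases neg_one_pow_eq_or ℝ (t + 1 + 1 + 1) with h | h
      · rw [h]; norm_num
      · rw [h]
    constructor
    · linarith
    · intro _
      linarith

lemma sum_prod_skewValue (g : Sym2 V → Fin 3 → ℝ) :
    ∑ y : Sym2 V → Fin 3, ∏ e, g e (y e) = ∏ e, ∑ a, g e a := by
  rw [Finset.prod_univ_sum, Fintype.piFinset_univ]

open Classical in
/-- Every paired walk contributes at least one to the mean over `y` of the trace of a power of the
matrix with entries `skewValue (y e)`, and the other walks contribute nonnegative amounts. -/
lemma card_paired_walks_le (N : ℕ) :
    (3 : ℝ) ^ Fintype.card (Sym2 V) *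
      (Finset.univ.filter fun w : Fin (N + 1) → V => IsPaired w).card ≤
      ∑ y : Sym2 V → Fin 3, (symMatrix (fun e => skewValue (y e)) ^ N).trace := by
  simp only [trace_symMatrix_pow_eq_sum_prod]
  rw [Finset.sum_comm]
  have h : ∀ w : Fin (N + 1) → V,
      ∑ y : Sym2 V → Fin 3, ∏ e, skewValue (y e) ^ traversals w e =
        ∏ e, ∑ a, skewValue a ^ traversals w e := fun w =>
    sum_prod_skewValue fun e a => skewValue a ^ traversals w e
  simp only [h]
  rw [mul_comm, ← nsmul_eq_mul, ← Finset.sum_const]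
  calc _ ≤ ∑ w : Fin (N + 1) → V with IsPaired w,
        ∏ e, ∑ a, skewValue a ^ traversals w e := by
        refine Finset.sum_le_sum fun w hw => ?_
        have hp := (Finset.mem_filter.1 hw).2
        rw [← Finset.card_univ, ← Finset.prod_const]
        exact Finset.prod_le_prod (fun _ _ => by norm_num) fun e _ =>
          (sum_skewValue_pow_bounds _).2 ((isPaired_iff_traversals hp.1).1 hp e)
    _ ≤ _ := by
        refine Finset.sum_le_sum_of_subset_of_nonneg (fun w hw => ?_) fun w _ _ => ?_
        · exact Finset.mem_filter.2 ⟨Finset.mem_univ _, (Finset.mem_filter.1 hw).2.1⟩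
        · exact Finset.prod_nonneg fun e _ => (sum_skewValue_pow_bounds _).1

lemma exp_le_add_exp_sq (x : ℝ) : Real.exp x ≤ x + Real.exp (x ^ 2) := by
  rcases le_or_gt |x| 1 with h | h
  · have h1 := (abs_le.1 (Real.abs_exp_sub_one_sub_id_le h)).2
    have h2 := Real.add_one_le_exp (x ^ 2)
    linarith
  · rcases le_or_gt 0 x with h0 | h0
    · rw [abs_of_nonneg h0] at h
      have : Real.exp x ≤ Real.exp (x ^ 2) := Real.exp_le_exp.2 (by nlinarith)
      linarith
    · rw [abs_of_neg h0] at h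
      have h1 : Real.exp x ≤ 1 := Real.exp_le_one_iff.2 h0.le
      have h2 := Real.add_one_le_exp (x ^ 2)
      nlinarith

lemma sum_exp_skewValue_le (t : ℝ) :
    ∑ a, Real.exp (t * skewValue a) ≤ 3 * Real.exp (4 * t ^ 2) := by
  have h1 := exp_le_add_exp_sq (t * 2)
  have h2 := exp_le_add_exp_sq (t * -1)
  have h3 : Real.exp ((t * 2) ^ 2) = Real.exp (4 * t ^ 2) := by ring_nf
  have h4 : Real.exp ((t * -1) ^ 2) ≤ Real.exp (4 * t ^ 2) :=
    Real.exp_le_exp.2 (by nlinarith [sq_nonneg t])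
  simp only [Fin.sum_univ_three, skewValue, Matrix.cons_val_zero, Matrix.cons_val_one,
    Matrix.cons_val]
  linarith

/-- The coefficient of the entry `e` in the quadratic form of a symmetric matrix. -/
def quadCoeff (x : V → ℝ) (e : Sym2 V) : ℝ := ∑ q : V × V with s(q.1, q.2) = e, x q.1 * x q.2

lemma quadForm_eq (x : V → ℝ) (f : Sym2 V → ℝ) :
    x ⬝ᵥ (symMatrix f *ᵥ x) = ∑ e, quadCoeff x e * f e := by
  have h : x ⬝ᵥ (symMatrix f *ᵥ x) = ∑ q : V × V, x q.1 * x q.2 * f s(q.1, q.2) := by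
    simp only [dotProduct, mulVec, symMatrix, of_apply, Finset.mul_sum, Fintype.sum_prod_type]
    exact Finset.sum_congr rfl fun i _ => Finset.sum_congr rfl fun j _ => by ring
  rw [h, ← Finset.sum_fiberwise Finset.univ (fun q : V × V => s(q.1, q.2))]
  refine Finset.sum_congr rfl fun e _ => ?_
  rw [quadCoeff, Finset.sum_mul]
  exact Finset.sum_congr rfl fun q hq => by rw [(Finset.mem_filter.1 hq).2]

lemma sum_quadCoeff_sq_le {x : V → ℝ} (hx : x ⬝ᵥ x = 1) : ∑ e, quadCoeff x e ^ 2 ≤ 2 := by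
  have hfib : ∀ e : Sym2 V,
      (Finset.univ.filter fun q : V × V => s(q.1, q.2) = e).card ≤ 2 := by
    intro e
    induction e using Sym2.ind with
    | _ a b =>
      refine (Finset.card_le_card (t := {(a, b), (b, a)}) fun q hq => ?_).trans
        Finset.card_le_two
      have := (Finset.mem_filter.1 hq).2
      rcases Sym2.eq_iff.1 this with ⟨h1, h2⟩ | ⟨h1, h2⟩
      · simp [Prod.ext_iff, h1, h2]
      · simp [Prod.ext_iff, h1, h2]
  calc ∑ e, quadCoeff x e ^ 2
      ≤ ∑ e : Sym2 V, 2 * ∑ q : V × V with s(q.1, q.2) = e, (x q.1 * x q.2) ^ 2 := by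
        refine Finset.sum_le_sum fun e _ => (sq_sum_le_card_mul_sum_sq).trans ?_
        gcongr
        exact_mod_cast hfib e
    _ = 2 * ∑ q : V × V, (x q.1 * x q.2) ^ 2 := by
        rw [← Finset.mul_sum, Finset.sum_fiberwise]
    _ = 2 * ((∑ i, x i ^ 2) * ∑ j, x j ^ 2) := by
        rw [Finset.sum_mul_sum, Fintype.sum_prod_type]
        simp only [mul_pow]
    _ ≤ 2 := by rw [← dotProduct_self_eq_sum_sq, hx]; norm_num

/-- The quadratic form at a unit vector is subgaussian. -/
lemma sum_exp_quadForm_le {x : V → ℝ} (hx : x ⬝ᵥ x = 1) (t : ℝ) :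
    ∑ y : Sym2 V → Fin 3,
      Real.exp (t * (x ⬝ᵥ (symMatrix (fun e => skewValue (y e)) *ᵥ x))) ≤
        3 ^ Fintype.card (Sym2 V) * Real.exp (8 * t ^ 2) := by
  simp only [quadForm_eq, Finset.mul_sum, Real.exp_sum]
  rw [sum_prod_skewValue fun e a => Real.exp (t * (quadCoeff x e * skewValue a))]
  calc _ ≤ ∏ e : Sym2 V, (3 * Real.exp (4 * (t * quadCoeff x e) ^ 2)) := by
        refine Finset.prod_le_prod (fun e _ => by positivity) fun e _ => ?_
        simp only [← mul_assoc]
        exact sum_exp_skewValue_le _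
    _ = 3 ^ Fintype.card (Sym2 V) * Real.exp (4 * t ^ 2 * ∑ e, quadCoeff x e ^ 2) := by
        rw [Finset.prod_mul_distrib, Finset.prod_const, Finset.card_univ, ← Real.exp_sum,
          Finset.mul_sum]
        simp only [mul_pow, mul_assoc]
    _ ≤ _ := by
        refine mul_le_mul_of_nonneg_left (Real.exp_le_exp.2 ?_) (by positivity)
        nlinarith [sum_quadCoeff_sq_le hx, sq_nonneg t]

/-- Moments of the quadratic form, from its exponential moments at `±√m`. -/
lemma sum_quadForm_pow_le {x : V → ℝ} (hx : x ⬝ᵥ x = 1) {m : ℕ} (hm : 1 ≤ m) :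
    ∑ y : Sym2 V → Fin 3, (x ⬝ᵥ (symMatrix (fun e => skewValue (y e)) *ᵥ x)) ^ (2 * m) ≤
      3 ^ Fintype.card (Sym2 V) * (2 * (4 * Real.exp 8 * m) ^ m) := by
  have hm' : (0 : ℝ) < m := by exact_mod_cast hm
  set t : ℝ := √m with ht
  have ht2 : t ^ 2 = m := Real.sq_sqrt hm'.le
  have hpt : ∀ S : ℝ, S ^ (2 * m) ≤ (4 * m) ^ m * (Real.exp (t * S) + Real.exp (-t * S)) := by
    intro S
    have h1 := Real.pow_div_factorial_le_exp |t * S| (abs_nonneg _) (2 * m)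
    rw [div_le_iff₀ (by positivity), (even_two_mul m).pow_abs, mul_pow, pow_mul t, ht2] at h1
    have h2 : Real.exp |t * S| ≤ Real.exp (t * S) + Real.exp (-t * S) := by
      rcases abs_cases (t * S) with ⟨h, -⟩ | ⟨h, -⟩ <;> rw [h]
      · linarith [Real.exp_pos (-t * S)]
      · rw [← neg_mul]; linarith [Real.exp_pos (t * S)]
    have h3 : ((2 * m).factorial : ℝ) ≤ (4 * m) ^ m * m ^ m := by
      have h4 : (2 * m).factorial ≤ (2 * m) ^ (2 * m) := Nat.factorial_le_pow _
      have h5 : ((2 * m).factorial : ℝ) ≤ ((2 * m : ℕ) : ℝ) ^ (2 * m) := by exact_mod_cast h4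
      refine h5.trans_eq ?_
      rw [pow_mul, ← mul_pow]
      push_cast
      ring
    refine le_of_mul_le_mul_left ?_ (pow_pos hm' m)
    calc _ ≤ Real.exp |t * S| * (2 * m).factorial := h1
      _ ≤ (Real.exp (t * S) + Real.exp (-t * S)) * ((4 * m) ^ m * m ^ m) := by gcongr
      _ = _ := by ring
  refine (Finset.sum_le_sum fun y _ => hpt _).trans ?_
  rw [← Finset.mul_sum, Finset.sum_add_distrib]
  have h1 := sum_exp_quadForm_le hx t
  have h2 := sum_exp_quadForm_le hx (-t)
  rw [neg_sq] at h2
  rw [ht2] at h1 h2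
  calc _ ≤ (4 * m : ℝ) ^ m * (3 ^ Fintype.card (Sym2 V) * Real.exp (8 * m) +
        3 ^ Fintype.card (Sym2 V) * Real.exp (8 * m)) := by gcongr
    _ = _ := by
      have h : (4 * Real.exp 8 * m) ^ m = (4 * m) ^ m * Real.exp 8 ^ m := by
        rw [← mul_pow]
        ring
      rw [mul_comm (8 : ℝ), Real.exp_nat_mul, h]
      ring

/-- A `1 / 2`-net of the unit sphere, in terms of the cosine of the angle: unit vectors at distance
`1 / 2` have the inner product `1 - (1 / 2) ^ 2 / 2 = 7 / 8`. -/
lemma exists_sphere_net (V : Type*) [Fintype V] [DecidableEq V] :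
    ∃ s : Finset (V → ℝ), s.card ≤ 5 ^ Fintype.card V ∧ (∀ x ∈ s, x ⬝ᵥ x = 1) ∧
      ∀ v : V → ℝ, v ⬝ᵥ v = 1 → ∃ x ∈ s, 7 / 8 ≤ x ⬝ᵥ v := by
  let Sep : Finset (EuclideanSpace ℝ V) → Prop := fun s =>
    (∀ x ∈ s, ‖x‖ = 1) ∧ ∀ x ∈ s, ∀ y ∈ s, x ≠ y → 1 / 2 ≤ ‖x - y‖
  have hcard : ∀ s, Sep s → s.card ≤ 5 ^ Fintype.card V := by
    rintro s ⟨h1, h2⟩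
    have hinj : Function.Injective fun x : EuclideanSpace ℝ V => (2 : ℝ) • x :=
      smul_right_injective _ two_ne_zero
    rw [← Finset.card_image_of_injective s hinj,
      ← finrank_euclideanSpace (𝕜 := ℝ) (ι := V)]
    refine Besicovitch.card_le_of_separated _ ?_ ?_
    · intro x' hx'
      obtain ⟨x, hx, rfl⟩ := Finset.mem_image.1 hx'
      simp [norm_smul, h1 x hx]
    · intro x' hx' y' hy' hxy
      obtain ⟨x, hx, rfl⟩ := Finset.mem_image.1 hx'
      obtain ⟨y, hy, rfl⟩ := Finset.mem_image.1 hy'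
      have := h2 x hx y hy fun h => hxy (by rw [h])
      rw [← smul_sub, norm_smul]
      norm_num
      linarith
  obtain ⟨s, hs, hmax⟩ : ∃ s, Sep s ∧ ∀ s', Sep s' → s'.card ≤ s.card := by
    have hb : BddAbove (Finset.card '' {s | Sep s}) :=
      ⟨5 ^ Fintype.card V, by rintro _ ⟨s, hs, rfl⟩; exact hcard s hs⟩
    have hne : (Finset.card '' {s | Sep s}).Nonempty := ⟨_, ∅, by simp [Sep], rfl⟩
    obtain ⟨s, hs, hs'⟩ := Nat.sSup_mem hne hb
    exact ⟨s, hs, fun s' h => hs' ▸ le_csSup hb ⟨s', h, rfl⟩⟩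
  have hinner : ∀ x y : EuclideanSpace ℝ V, inner ℝ x y = x.ofLp ⬝ᵥ y.ofLp := fun x y => by
    rw [EuclideanSpace.inner_eq_star_dotProduct, dotProduct_comm]
    simp
  refine ⟨s.map ⟨fun x => x.ofLp, WithLp.ofLp_injective 2⟩, ?_, ?_, ?_⟩
  · rw [Finset.card_map]
    exact hcard s hs
  · intro x' hx'
    obtain ⟨x, hx, rfl⟩ := Finset.mem_map.1 hx'
    have := real_inner_self_eq_norm_sq x
    rw [hs.1 x hx, hinner] at this
    simpa using this
  · intro v hv
    set v' : EuclideanSpace ℝ V := WithLp.toLp 2 v with hv'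
    have hv1 : ‖v'‖ = 1 := by
      have := real_inner_self_eq_norm_sq v'
      rw [hinner] at this
      have h1 : ‖v'‖ ^ 2 = 1 := by rw [← this]; exact hv
      exact (pow_eq_one_iff_of_nonneg (norm_nonneg _) two_ne_zero).1 h1
    obtain ⟨x, hx, hxv⟩ : ∃ x ∈ s, ‖x - v'‖ < 1 / 2 := by
      by_contra! hcon
      have hnot : v' ∉ s := fun h => by
        have := hcon v' h
        rw [sub_self, norm_zero] at this
        linarith
      have := hmax (insert v' s) ⟨?_, ?_⟩
      · rw [Finset.card_insert_of_notMem hnot] at this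
        omega
      · intro x hx
        rcases Finset.mem_insert.1 hx with rfl | hx
        · exact hv1
        · exact hs.1 x hx
      · intro x hx y hy hxy
        rcases Finset.mem_insert.1 hx with rfl | hx <;> rcases Finset.mem_insert.1 hy with rfl | hy
        · exact absurd rfl hxy
        · rw [norm_sub_rev]; exact hcon y hy
        · exact hcon x hx
        · exact hs.2 x hx y hy hxy
    refine ⟨x.ofLp, Finset.mem_map.2 ⟨x, hx, rfl⟩, ?_⟩
    have h1 := norm_sub_sq_real x v'
    rw [hs.1 x hx, hv1, hinner] at h1
    have h2 : ‖x - v'‖ ^ 2 ≤ (1 / 2) ^ 2 := by gcongr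
    have h3 : x.ofLp ⬝ᵥ v'.ofLp = x.ofLp ⬝ᵥ v := rfl
    rw [h3] at h1
    linarith

/-- Near the eigenvector of its largest eigenvalue, the quadratic form of a symmetric matrix is
still at least half of the operator norm. -/
lemma trace_pow_le_sum_net {M : Matrix V V ℝ} (hM : M.IsSymm) {s : Finset (V → ℝ)}
    (hs1 : ∀ x ∈ s, x ⬝ᵥ x = 1)
    (hs : ∀ v : V → ℝ, v ⬝ᵥ v = 1 → ∃ x ∈ s, 7 / 8 ≤ x ⬝ᵥ v) (m : ℕ) :
    (M ^ (2 * m)).trace ≤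
      Fintype.card V * (4 ^ m * ∑ x ∈ s, (x ⬝ᵥ (M *ᵥ x)) ^ (2 * m)) := by
  obtain ⟨Q, d, h1, h2, hQ⟩ := hM.exists_orthogonal_diagonalization
  rw [trace_pow_of_diagonalized h1 hQ]
  have hmain : ∀ i, d i ^ (2 * m) ≤ 4 ^ m * ∑ x ∈ s, (x ⬝ᵥ (M *ᵥ x)) ^ (2 * m) := by
    intro i'
    obtain ⟨i, -, hi⟩ := Finset.exists_max_image Finset.univ (fun i => |d i|)
      ⟨i', Finset.mem_univ _⟩
    obtain ⟨x, hx, hxv⟩ := hs (Q *ᵥ Pi.single i 1) (by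
      rw [mulVec_dotProduct_mulVec_of_transpose_mul_self h1]; simp)
    set q := Qᵀ *ᵥ x with hq
    have h2' : Qᵀᵀ * Qᵀ = 1 := by rwa [transpose_transpose]
    have hqi : 7 / 8 ≤ q i := by
      rw [dotProduct_mulVec, ← mulVec_transpose, ← hq] at hxv
      simpa using hxv
    have hq1 : ∑ j, q j ^ 2 = 1 := by
      rw [← dotProduct_self_eq_sum_sq, mulVec_dotProduct_mulVec_of_transpose_mul_self h2',
        hs1 x hx]
    have hform : x ⬝ᵥ (M *ᵥ x) = ∑ j, d j * q j ^ 2 := by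
      rw [hQ, ← mulVec_mulVec, ← mulVec_mulVec, dotProduct_mulVec, ← mulVec_transpose]
      simp only [dotProduct, mulVec_diagonal, ← hq]
      exact Finset.sum_congr rfl fun j _ => by ring
    rw [← Finset.add_sum_erase _ _ (Finset.mem_univ i)] at hq1
    have hrest : |∑ j ∈ Finset.univ.erase i, d j * q j ^ 2| ≤ |d i| * (1 - q i ^ 2) := by
      refine (Finset.abs_sum_le_sum_abs _ _).trans ?_
      rw [← hq1, add_sub_cancel_left, Finset.mul_sum]
      refine Finset.sum_le_sum fun j _ => ?_
      rw [abs_mul, abs_of_nonneg (sq_nonneg (q j))]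
      exact mul_le_mul_of_nonneg_right (hi j (Finset.mem_univ _)) (sq_nonneg _)
    have hlow : |d i| ≤ 2 * |x ⬝ᵥ (M *ᵥ x)| := by
      rw [hform, ← Finset.add_sum_erase _ (fun j => d j * q j ^ 2) (Finset.mem_univ i)]
      set R := ∑ j ∈ Finset.univ.erase i, d j * q j ^ 2
      have h3 := abs_sub_abs_le_abs_sub (d i * q i ^ 2) (-R)
      rw [sub_neg_eq_add, abs_neg, abs_mul, abs_of_nonneg (sq_nonneg (q i))] at h3
      have h4 : (49 / 64 : ℝ) ≤ q i ^ 2 := by nlinarith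
      have h5 := mul_le_mul_of_nonneg_left h4 (abs_nonneg (d i))
      rw [mul_sub, mul_one] at hrest
      linarith [abs_nonneg (d i)]
    calc d i' ^ (2 * m) = |d i'| ^ (2 * m) := ((even_two_mul m).pow_abs _).symm
      _ ≤ (2 * |x ⬝ᵥ (M *ᵥ x)|) ^ (2 * m) := by
        gcongr
        exact (hi i' (Finset.mem_univ _)).trans hlow
      _ = 4 ^ m * (x ⬝ᵥ (M *ᵥ x)) ^ (2 * m) := by
        rw [mul_pow, (even_two_mul m).pow_abs, pow_mul 2]
        norm_num
      _ ≤ _ := by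
        gcongr
        exact Finset.single_le_sum (f := fun x => (x ⬝ᵥ (M *ᵥ x)) ^ (2 * m))
          (fun y _ => by rw [pow_mul]; positivity) hx
  refine (Finset.sum_le_sum fun i _ => hmain i).trans ?_
  rw [Finset.sum_const, nsmul_eq_mul, Finset.card_univ]

open Classical in
/-- The number of paired closed walks of length `2m` on `2m` vertices. -/
lemma card_paired_walks_square_le {m : ℕ} (hm : 1 ≤ m) :
    ((Finset.univ.filter fun w : Fin (2 * m + 1) → Fin (2 * m) => IsPaired w).card : ℝ) ≤
      ((2 * m : ℕ) : ℝ) * (2 * (400 * Real.exp 8 * m) ^ m) := by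
  obtain ⟨s, hcard, hs1, hs⟩ := exists_sphere_net (Fin (2 * m))
  rw [Fintype.card_fin] at hcard
  have h3 : (0 : ℝ) < 3 ^ Fintype.card (Sym2 (Fin (2 * m))) := by positivity
  refine le_of_mul_le_mul_left ((card_paired_walks_le (2 * m)).trans ?_) h3
  calc _ ≤ ∑ y : Sym2 (Fin (2 * m)) → Fin 3, (Fintype.card (Fin (2 * m)) : ℝ) * (4 ^ m *
        ∑ x ∈ s, (x ⬝ᵥ (symMatrix (fun e => skewValue (y e)) *ᵥ x)) ^ (2 * m)) :=
        Finset.sum_le_sum fun y _ => trace_pow_le_sum_net (symMatrix_isSymm _) hs1 hs m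
    _ = ((2 * m : ℕ) : ℝ) * (4 ^ m * ∑ x ∈ s, ∑ y : Sym2 (Fin (2 * m)) → Fin 3,
          (x ⬝ᵥ (symMatrix (fun e => skewValue (y e)) *ᵥ x)) ^ (2 * m)) := by
        rw [← Finset.mul_sum, ← Finset.mul_sum, Finset.sum_comm, Fintype.card_fin]
    _ ≤ ((2 * m : ℕ) : ℝ) * (4 ^ m * ∑ _x ∈ s, 3 ^ Fintype.card (Sym2 (Fin (2 * m))) *
          (2 * (4 * Real.exp 8 * m) ^ m)) := by
        gcongr with x hx
        exact sum_quadForm_pow_le (hs1 x hx) hm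
    _ = ((2 * m : ℕ) : ℝ) * (4 ^ m * (s.card * (3 ^ Fintype.card (Sym2 (Fin (2 * m))) *
          (2 * (4 * Real.exp 8 * m) ^ m)))) := by rw [Finset.sum_const, nsmul_eq_mul]
    _ ≤ ((2 * m : ℕ) : ℝ) * (4 ^ m * (5 ^ (2 * m) * (3 ^ Fintype.card (Sym2 (Fin (2 * m))) *
          (2 * (4 * Real.exp 8 * m) ^ m)))) := by
        gcongr
        exact_mod_cast hcard
    _ = _ := by
        have : (400 * Real.exp 8 * m) ^ m =
            4 ^ m * ((5 ^ 2) ^ m * (4 * Real.exp 8 * m) ^ m) := by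
          rw [← mul_pow, ← mul_pow]
          congr 1
          ring
        rw [this, pow_mul 5]
        ring

end Moments

/-! ### The operator norm of a sparse random matrix -/

section OperatorNorm

variable {n : ℕ}

lemma trace_pow_nonneg {V : Type*} [Fintype V] [DecidableEq V] {M : Matrix V V ℝ}
    (hM : M.IsSymm) (m : ℕ) : 0 ≤ (M ^ (2 * m)).trace := by
  obtain ⟨Q, d, h1, -, hQ⟩ := hM.exists_orthogonal_diagonalization
  rw [trace_pow_of_diagonalized h1 hQ]
  exact Finset.sum_nonneg fun i _ => by rw [pow_mul]; positivity

/-- Tail bound for the Schatten norm of order `2m`, where `m` is at least the mean degree. -/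
lemma measure_trace_pow_ge_le {Ω : Type*} [MeasurableSpace Ω] {P : Measure Ω}
    [IsProbabilityMeasure P] {X : Sym2 (Fin n) → Ω → ℝ} {p : ℝ}
    (hind : ∀ t : Sym2 (Fin n) → ℕ, ∫ ω, ∏ e, X e ω ^ t e ∂P = ∏ e, ∫ ω, X e ω ^ t e ∂P)
    (hmeas : ∀ e, Measurable (X e)) (hbd : ∀ e ω, |X e ω| ≤ 1)
    (hmean : ∀ e, ∫ ω, X e ω ∂P = 0) (hvar : ∀ e, ∫ ω, X e ω ^ 2 ∂P ≤ p)
    (hp0 : 0 ≤ p) (hp1 : p ≤ 1) {m : ℕ} (hm : 1 ≤ m) (hnp : n * p ≤ m) (s : ℝ) :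
    P.real {ω | (400 * Real.exp 8 * m * Real.exp s) ^ m ≤
        (symMatrix (fun e => X e ω) ^ (2 * m)).trace} ≤ 2 * n * Real.exp (-(s * m)) := by
  have hm' : (0 : ℝ) < m := by exact_mod_cast hm
  have h1 := integral_trace_pow_le hind hmeas hbd hmean hvar (2 * m)
  have h2 := sum_paired_walks_le (V := Fin n) hp0 hp1 (by simpa using hnp) hm
  have h3 := card_paired_walks_square_le hm
  rw [Fintype.card_fin] at h2
  have h4 : ∫ ω, (symMatrix (fun e => X e ω) ^ (2 * m)).trace ∂P ≤
      2 * n * (400 * Real.exp 8 * m) ^ m := by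
    have h2m : (0 : ℝ) < ((2 * m : ℕ) : ℝ) := by exact_mod_cast (by omega : 0 < 2 * m)
    refine h1.trans (le_of_mul_le_mul_left (h2.trans ?_) h2m)
    calc _ ≤ (n : ℝ) * (((2 * m : ℕ) : ℝ) * (2 * (400 * Real.exp 8 * m) ^ m)) := by gcongr
      _ = _ := by ring
  have h5 := mul_meas_ge_le_integral_of_nonneg (μ := P)
    (Filter.Eventually.of_forall fun ω => trace_pow_nonneg (symMatrix_isSymm fun e => X e ω) m)
    (integrable_trace_pow hmeas hbd (2 * m)) ((400 * Real.exp 8 * m * Real.exp s) ^ m)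
  have h6 : 0 < (400 * Real.exp 8 * m * Real.exp s) ^ m := by positivity
  refine le_of_mul_le_mul_left ((h5.trans h4).trans_eq ?_) h6
  have h7 : Real.exp s ^ m * Real.exp (-(s * m)) = 1 := by
    rw [← Real.exp_nat_mul, ← Real.exp_add, mul_comm s, add_neg_cancel, Real.exp_zero]
  rw [mul_pow _ (Real.exp s)]
  linear_combination (-(2 * n * (400 * Real.exp 8 * m) ^ m)) * h7

end OperatorNorm

/-! ### Edges of the CHIP model -/

section Model

/-- The indicator that at least one event occurs up to time `T`. -/
noncomputable def edgeIndicator (T : ℝ) (s : ℕ → ℝ≥0∞) : ℝ :=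
  open Classical in if 0 < count T s then 1 else 0

lemma count_pos_iff {T : ℝ} {s : ℕ → ℝ≥0∞} : 0 < count T s ↔ ∃ q, s q ≤ ENNReal.ofReal T := by
  rw [count, Set.encard_pos]
  rfl

lemma measurable_edgeIndicator (T : ℝ) : Measurable (edgeIndicator T) := by
  refine Measurable.ite ?_ measurable_const measurable_const
  have : {s : ℕ → ℝ≥0∞ | 0 < count T s} = ⋃ q, {s | s q ≤ ENNReal.ofReal T} := by
    ext s
    simp [count_pos_iff]
  rw [this]
  exact MeasurableSet.iUnion fun q => measurableSet_le (measurable_pi_apply q) measurable_const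

lemma edgeIndicator_eq_zero_or_one (T : ℝ) (s : ℕ → ℝ≥0∞) :
    edgeIndicator T s = 0 ∨ edgeIndicator T s = 1 := by
  unfold edgeIndicator
  split_ifs <;> simp

lemma adjacency_apply {Ω : Type*} {n : ℕ} {T : ℝ} {t : Fin n → Fin n → ℕ → Ω → ℝ≥0∞} {ω : Ω}
    {i j : Fin n} (hij : i ≠ j) :
    adjacency T t ω i j = edgeIndicator T fun q => t i j q ω := by
  simp [adjacency, edgeIndicator, hij]


section Hawkes

variable {Ω : Type*} [MeasurableSpace Ω] {P : Measure Ω} {μ α β T : ℝ} {τ : ℕ → Ω → ℝ≥0∞}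

lemma IsHawkes.ae_edgeIndicator (h : IsHawkes P μ α β τ) :
    (fun ω => edgeIndicator T fun q => τ q ω) =ᵐ[P]
      {ω | ENNReal.ofReal T < τ 0 ω}ᶜ.indicator fun _ => 1 := by
  filter_upwards [h.increasing, h.stays_top] with ω h1 h2
  have hmono : ∀ q, τ 0 ω ≤ τ q ω := fun q => by
    induction q with
    | zero => exact le_rfl
    | succ q ih =>
      rcases eq_or_ne (τ q ω) ⊤ with ht | ht
      · rw [h2 q ht]; exact le_top
      · exact ih.trans (h1 q (lt_top_iff_ne_top.2 ht)).le
  have hiff : 0 < count T (fun q => τ q ω) ↔ τ 0 ω ≤ ENNReal.ofReal T := by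
    rw [count_pos_iff]
    exact ⟨fun ⟨q, hq⟩ => (hmono q).trans hq, fun h => ⟨0, h⟩⟩
  simp [edgeIndicator, Set.indicator_apply, hiff]

lemma IsHawkes.measurable_edge (h : IsHawkes P μ α β τ) :
    Measurable fun ω => edgeIndicator T fun q => τ q ω :=
  (measurable_edgeIndicator T).comp (measurable_pi_lambda _ h.measurable)

variable [IsProbabilityMeasure P]

/-- The first event of a Hawkes process occurs after an exponential time. -/
lemma IsHawkes.measureReal_lt_first (h : IsHawkes P μ α β τ) (hT : 0 < T) :
    P.real {ω | ENNReal.ofReal T < τ 0 ω} = Real.exp (-(μ * T)) := by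
  obtain ⟨ω, hω⟩ := (h.survival 0 T.toNNReal).exists
  have hbot : pastSigma τ 0 = ⊥ := iSup_of_empty _
  have := hω (by simp [lastTime])
  rw [hbot, condExp_bot] at this
  have hms : MeasurableSet {ω' | (T.toNNReal : ℝ≥0∞) < τ 0 ω'} :=
    measurableSet_lt measurable_const (h.measurable 0)
  rw [integral_indicator hms] at this
  simpa [intensity, lastTime, hT.le, mul_comm, ENNReal.ofReal] using this

lemma IsHawkes.integrable_edge (h : IsHawkes P μ α β τ) :
    Integrable (fun ω => edgeIndicator T fun q => τ q ω) P := by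
  refine Integrable.of_bound h.measurable_edge.aestronglyMeasurable 1
    (Filter.Eventually.of_forall fun ω => ?_)
  rcases edgeIndicator_eq_zero_or_one T fun q => τ q ω with h | h <;> simp [h]

lemma IsHawkes.integral_edge (h : IsHawkes P μ α β τ) (hT : 0 < T) :
    ∫ ω, edgeIndicator T (fun q => τ q ω) ∂P = 1 - Real.exp (-(μ * T)) := by
  have hms : MeasurableSet {ω | ENNReal.ofReal T < τ 0 ω} :=
    measurableSet_lt measurable_const (h.measurable 0)
  rw [integral_congr_ae h.ae_edgeIndicator, integral_indicator hms.compl,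
    ← h.measureReal_lt_first hT, ← probReal_compl_eq_one_sub hms]
  simp

end Hawkes

section Chip

variable {Ω : Type*} {n k : ℕ} {c : Fin n → Fin k} {μ α β : Matrix (Fin k) (Fin k) ℝ}
  {t : Fin n → Fin n → ℕ → Ω → ℝ≥0∞} {T : ℝ}

/-- The centered adjacency variable of an unordered pair of nodes; `0` for a loop. -/
noncomputable def centeredEdge (c : Fin n → Fin k) (μ : Matrix (Fin k) (Fin k) ℝ)
    (t : Fin n → Fin n → ℕ → Ω → ℝ≥0∞) (T : ℝ) (e : Sym2 (Fin n)) (ω : Ω) : ℝ :=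
  if e.inf = e.sup then 0
  else edgeIndicator T (fun q => t e.inf e.sup q ω) - meanAdjacency c μ T e.inf e.sup

lemma centeredEdge_of_lt {i j : Fin n} (hij : i < j) (ω : Ω) : centeredEdge c μ t T s(i, j) ω =
    edgeIndicator T (fun q => t i j q ω) - meanAdjacency c μ T i j := by
  have h1 : (s(i, j) : Sym2 (Fin n)).inf = i := by simp [hij.le]
  have h2 : (s(i, j) : Sym2 (Fin n)).sup = j := by simp [hij.le]
  rw [centeredEdge, h1, h2, if_neg hij.ne]

lemma centeredEdge_diag (i : Fin n) (ω : Ω) : centeredEdge c μ t T s(i, i) ω = 0 := by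
  simp [centeredEdge]

lemma sym2_cases {p : Sym2 (Fin n) → Prop} (hd : ∀ i, p s(i, i)) (hlt : ∀ i j, i < j → p s(i, j))
    (e : Sym2 (Fin n)) : p e := by
  induction e using Sym2.ind with
  | _ i j =>
    rcases lt_trichotomy i j with h | h | h
    · exact hlt i j h
    · subst h; exact hd i
    · rw [Sym2.eq_swap]; exact hlt j i h

lemma prod_sym2 (F : Sym2 (Fin n) → ℝ) :
    ∏ e, F e = (∏ i, F s(i, i)) * ∏ p : {p : Fin n × Fin n // p.1 < p.2}, F s(p.1.1, p.1.2) := by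
  classical
  let φ : Fin n ⊕ {p : Fin n × Fin n // p.1 < p.2} → Sym2 (Fin n) :=
    Sum.elim (fun i => s(i, i)) fun p => s(p.1.1, p.1.2)
  have hφ : Function.Bijective φ := by
    constructor
    · rintro (i | ⟨⟨i, j⟩, hij⟩) (i' | ⟨⟨i', j'⟩, hij'⟩) h
      · have := Sym2.eq_iff.1 h
        grind
      · have := Sym2.eq_iff.1 h
        grind
      · have := Sym2.eq_iff.1 h
        grind
      · have := Sym2.eq_iff.1 h
        grind
    · exact sym2_cases (fun i => ⟨Sum.inl i, rfl⟩) fun i j hij => ⟨Sum.inr ⟨(i, j), hij⟩, rfl⟩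
  rw [← (Equiv.ofBijective φ hφ).prod_comp, Fintype.prod_sum_type]
  rfl

lemma meanAdjacency_le_one (c : Fin n → Fin k) (μ : Matrix (Fin k) (Fin k) ℝ) (T : ℝ)
    (i j : Fin n) : meanAdjacency c μ T i j ≤ 1 := by
  simp [meanAdjacency, (Real.exp_pos _).le]

variable [MeasurableSpace Ω] {P : Measure Ω}

lemma IsCHIP.meanAdjacency_mem (h : IsCHIP P c μ α β t) (hT : 0 < T) (i j : Fin n) :
    meanAdjacency c μ T i j ∈ Set.Icc 0 (1 - Real.exp (-(maxEntry μ * T))) := by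
  have hmax : μ (c i) (c j) ≤ maxEntry μ :=
    le_ciSup (f := fun p : Fin k × Fin k => μ p.1 p.2) (Set.finite_range _).bddAbove (c i, c j)
  have h0 := h.mu_nonneg (c i) (c j)
  simp only [meanAdjacency, of_apply, Set.mem_Icc, sub_nonneg, Real.exp_le_one_iff,
    Left.neg_nonpos_iff, tsub_le_iff_right]
  refine ⟨by positivity, ?_⟩
  have : Real.exp (-(maxEntry μ * T)) ≤ Real.exp (-(μ (c i) (c j) * T)) :=
    Real.exp_le_exp.2 (neg_le_neg (by gcongr))
  linarith

lemma IsCHIP.measurable_centeredEdge (h : IsCHIP P c μ α β t) (e : Sym2 (Fin n)) :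
    Measurable (centeredEdge c μ t T e) := by
  induction e using sym2_cases with
  | hd i =>
    simp only [funext (centeredEdge_diag i), measurable_const]
  | hlt i j hij =>
    simp only [funext (centeredEdge_of_lt hij)]
    exact (h.hawkes i j hij.ne).measurable_edge.sub_const _

lemma IsCHIP.abs_centeredEdge_le (h : IsCHIP P c μ α β t) (hT : 0 < T) (e : Sym2 (Fin n))
    (ω : Ω) : |centeredEdge c μ t T e ω| ≤ 1 := by
  induction e using sym2_cases with
  | hd i =>
    rw [centeredEdge_diag]; simp
  | hlt i j hij =>
    rw [centeredEdge_of_lt hij]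
    have h0 := (h.meanAdjacency_mem hT i j).1
    have h1 := meanAdjacency_le_one c μ T i j
    rcases edgeIndicator_eq_zero_or_one T fun q => t i j q ω with h | h <;> rw [h, abs_le] <;>
      constructor <;> linarith

lemma IsCHIP.adjacency_sub_meanAdjacency (h : IsCHIP P c μ α β t) (ω : Ω) :
    adjacency T t ω - meanAdjacency c μ T =
      symMatrix (fun e => centeredEdge c μ t T e ω) -
        diagonal fun i => meanAdjacency c μ T i i := by
  ext i j
  simp only [Matrix.sub_apply, symMatrix, of_apply]
  rcases lt_trichotomy i j with hij | hij | hij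
  · rw [adjacency_apply hij.ne, centeredEdge_of_lt hij, diagonal_apply_ne _ hij.ne, sub_zero]
  · subst hij
    rw [centeredEdge_diag, diagonal_apply_eq]
    simp [adjacency]
  · have hs : meanAdjacency c μ T i j = meanAdjacency c μ T j i := by
      simp [meanAdjacency, h.mu_symm.apply (c i) (c j)]
    rw [adjacency_apply hij.ne', Sym2.eq_swap, centeredEdge_of_lt hij,
      diagonal_apply_ne _ hij.ne', sub_zero, h.undirected i j, hs]

/-- A bound for the trace of a high power of the centered adjacency matrix gives an operator norm
bound for the deviation of the adjacency matrix from the full block matrix; the diagonal of the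
block matrix is negligible. -/
lemma IsCHIP.deviation_le (h : IsCHIP P c μ α β t) (hT : 0 < T) {m : ℕ} (hm : m ≠ 0) {b : ℝ}
    (hb : 0 ≤ b) {ω : Ω}
    (htr : (symMatrix (fun e => centeredEdge c μ t T e ω) ^ (2 * m)).trace ≤ b ^ m)
    (x : Fin n → ℝ) :
    ((adjacency T t ω - meanAdjacency c μ T) *ᵥ x) ⬝ᵥ
        ((adjacency T t ω - meanAdjacency c μ T) *ᵥ x) ≤
      (2 * b + 2 * (1 - Real.exp (-(maxEntry μ * T)))) * (x ⬝ᵥ x) := by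
  rw [h.adjacency_sub_meanAdjacency, sub_mulVec, sub_eq_add_neg]
  refine (dotProduct_self_add_le _ _).trans ?_
  have h1 := mulVec_dotProduct_le_of_trace_pow_le (symMatrix_isSymm _) hm hb htr x
  have h2 : (diagonal (fun i => meanAdjacency c μ T i i) *ᵥ x) ⬝ᵥ
      (diagonal (fun i => meanAdjacency c μ T i i) *ᵥ x) ≤
        (1 - Real.exp (-(maxEntry μ * T))) * (x ⬝ᵥ x) := by
    rw [dotProduct_self_eq_sum_sq, dotProduct_self_eq_sum_sq, Finset.mul_sum]
    refine Finset.sum_le_sum fun i _ => ?_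
    rw [mulVec_diagonal, mul_pow]
    have h3 := h.meanAdjacency_mem hT i i
    have h4 := meanAdjacency_le_one c μ T i i
    refine mul_le_mul_of_nonneg_right ?_ (sq_nonneg _)
    nlinarith [h3.1, h3.2]
  rw [neg_dotProduct_neg]
  linarith

variable [IsProbabilityMeasure P]

lemma IsCHIP.integral_centeredEdge (h : IsCHIP P c μ α β t) (hT : 0 < T) (e : Sym2 (Fin n)) :
    ∫ ω, centeredEdge c μ t T e ω ∂P = 0 := by
  induction e using sym2_cases with
  | hd i =>
    simp only [centeredEdge_diag, integral_zero]
  | hlt i j hij =>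
    simp only [centeredEdge_of_lt hij]
    have hH := h.hawkes i j hij.ne
    rw [integral_sub hH.integrable_edge (integrable_const _), hH.integral_edge hT]
    simp [meanAdjacency]

lemma IsCHIP.integral_centeredEdge_sq_le (h : IsCHIP P c μ α β t) (hT : 0 < T)
    (e : Sym2 (Fin n)) :
    ∫ ω, centeredEdge c μ t T e ω ^ 2 ∂P ≤ 1 - Real.exp (-(maxEntry μ * T)) := by
  induction e using sym2_cases with
  | hd i =>
    simp only [centeredEdge_diag]
    have := h.meanAdjacency_mem hT i i
    simpa using this.1.trans this.2
  | hlt i j hij =>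
    simp only [centeredEdge_of_lt hij]
    have hH := h.hawkes i j hij.ne
    have hm := h.meanAdjacency_mem hT i j
    set q := meanAdjacency c μ T i j with hq
    have hsq : ∀ ω, (edgeIndicator T (fun q => t i j q ω) - q) ^ 2 =
        (1 - 2 * q) * edgeIndicator T (fun q => t i j q ω) + q ^ 2 := fun ω => by
      rcases edgeIndicator_eq_zero_or_one T fun q => t i j q ω with h | h <;> rw [h] <;> ring
    simp only [hsq]
    rw [integral_add (hH.integrable_edge.const_mul _) (integrable_const _), integral_const_mul,
      hH.integral_edge hT]
    have : 1 - Real.exp (-(μ (c i) (c j) * T)) = q := rfl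
    rw [this]
    simp only [integral_const, probReal_univ, one_smul]
    nlinarith [hm.2, sq_nonneg q]

/-- Mixed moments of the centered adjacency variables factor. -/
lemma IsCHIP.integral_prod_centeredEdge (h : IsCHIP P c μ α β t) (s : Sym2 (Fin n) → ℕ) :
    ∫ ω, ∏ e, centeredEdge c μ t T e ω ^ s e ∂P =
      ∏ e, ∫ ω, centeredEdge c μ t T e ω ^ s e ∂P := by
  rw [prod_sym2]
  simp only [prod_sym2 fun e => centeredEdge c μ t T e _ ^ s e, centeredEdge_diag]
  rw [integral_const_mul]
  congr 1
  · simp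
  · have hind : iIndepFun (fun (p : {p : Fin n × Fin n // p.1 < p.2}) (ω : Ω) =>
        centeredEdge c μ t T s(p.1.1, p.1.2) ω) P := by
      have := h.indep.comp
        (fun p x => edgeIndicator T x - meanAdjacency c μ T p.1.1 p.1.2)
        fun p => (measurable_edgeIndicator T).sub_const _
      convert this using 2 with p
      ext ω
      exact centeredEdge_of_lt p.2 ω
    exact hind.integral_fun_prod_comp (f := fun p x => x ^ s s(p.1.1, p.1.2))
      (fun p => (h.measurable_centeredEdge _).aemeasurable)
      (fun p => (measurable_id.pow_const _).aestronglyMeasurable)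

end Chip

end Model

/-- The failure probability for a moment of order at least `log n`. -/
lemma two_mul_mul_exp_le {n m : ℕ} (hn : 2 ≤ n) {r : ℝ} (hr : 0 < r) (hm : Real.log n ≤ m) :
    2 * n * Real.exp (-((r + 2) * m)) ≤ (n : ℝ) ^ (-r) := by
  have hn' : (2 : ℝ) ≤ n := by exact_mod_cast hn
  have hpos : (0 : ℝ) < n := by linarith
  have h1 : Real.exp (-((r + 2) * m)) ≤ (n : ℝ) ^ (-r) * ((n : ℝ) ^ 2)⁻¹ := by
    rw [← Real.rpow_natCast, ← Real.rpow_neg hpos.le, ← Real.rpow_add hpos,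
      Real.rpow_def_of_pos hpos]
    refine Real.exp_le_exp.2 ?_
    push_cast
    nlinarith
  have h2 : 0 < (n : ℝ) ^ (-r) := Real.rpow_pos_of_pos hpos _
  calc 2 * n * Real.exp (-((r + 2) * m)) ≤ 2 * n * ((n : ℝ) ^ (-r) * ((n : ℝ) ^ 2)⁻¹) := by gcongr
    _ = (n : ℝ) ^ (-r) * (2 / n) := by field_simp
    _ ≤ (n : ℝ) ^ (-r) * 1 := by
      gcongr
      rw [div_le_one hpos]
      exact hn'
    _ = _ := mul_one _

end CHIP

theorem theorem1 (c₀ r : ℝ) (hc₀ : 0 < c₀) (hr : 0 < r) :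
    ∃ C : ℝ, 0 < C ∧
      ∀ {Ω : Type*} [MeasurableSpace Ω] (P : Measure Ω) [IsProbabilityMeasure P]
        (n k : ℕ) (_ : 1 ≤ k) (c : Fin n → Fin k) (μ α β : Matrix (Fin k) (Fin k) ℝ)
        (t : Fin n → Fin n → ℕ → Ω → ℝ≥0∞) (_ : CHIP.IsCHIP P c μ α β t)
        (T : ℝ) (_ : 0 < T) (_ : (CHIP.meanAdjacency c μ T).rank = k) (ε : ℝ) (_ : 0 < ε),
        (∀ i j, i ≠ j →
          Integrable (fun ω => CHIP.adjacency T t ω i j) P ∧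
          ∫ ω, CHIP.adjacency T t ω i j ∂P = CHIP.meanAdjacency c μ T i j) ∧
        1 - (n : ℝ) ^ (-r) ≤
          P.real {ω | ∀ z : Fin n → Fin k,
            CHIP.IsSpectralClustering ε (CHIP.adjacency T t ω) z →
            CHIP.misclusteringRate c z ≤
              64 * (2 + ε) *
                ((CHIP.maxBlockSize c : ℝ) * k * C * CHIP.Delta n μ T c₀ /
                  (n * CHIP.lambdaMin (CHIP.meanAdjacency c μ T) ^ 2))} := by
  set K : ℝ := 400 * Real.exp 8 * Real.exp (r + 2) with hK
  have hKpos : 0 < K := by positivity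
  have hlog2 : 0 < Real.log 2 := Real.log_pos one_lt_two
  -- the order of the moment is `m = ⌈max 1 c₀⁻¹ * Δ⌉`, which is at most `κ * Δ`
  set κ : ℝ := max 1 c₀⁻¹ + (c₀ * Real.log 2)⁻¹ with hκ
  have hmax1 : (1 : ℝ) ≤ max 1 c₀⁻¹ := le_max_left _ _
  have hκpos : 0 < κ := by positivity
  refine ⟨2 * (K * κ) + 2, by positivity, ?_⟩
  intro Ω _ P _ n k hk c μ α β t hC T hT hrank ε hε
  refine ⟨fun i j hij => ?_, ?_⟩
  · simp only [CHIP.adjacency_apply hij]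
    exact ⟨(hC.hawkes i j hij).integrable_edge, (hC.hawkes i j hij).integral_edge hT⟩
  rcases Nat.lt_or_ge n 2 with hn | hn
  · rcases Nat.lt_or_ge n 1 with hn0 | hn1
    · exfalso
      have := (CHIP.meanAdjacency c μ T).rank_le_width
      omega
    · obtain rfl : n = 1 := by omega
      simp
  have hn' : (2 : ℝ) ≤ n := by exact_mod_cast hn
  set p : ℝ := 1 - Real.exp (-(CHIP.maxEntry μ * T)) with hp
  set Δ : ℝ := CHIP.Delta n μ T c₀ with hΔ
  have hΔ1 : n * p ≤ Δ := le_max_left _ _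
  have hΔ2 : c₀ * Real.log n ≤ Δ := le_max_right _ _
  have hlog : Real.log 2 ≤ Real.log n := Real.log_le_log two_pos hn'
  have hΔ3 : c₀ * Real.log 2 ≤ Δ := (by gcongr : _ ≤ c₀ * Real.log n).trans hΔ2
  have hΔpos : 0 < Δ := lt_of_lt_of_le (by positivity) hΔ3
  have hp0 : 0 ≤ p := by
    have := hC.meanAdjacency_mem hT (⟨0, by omega⟩ : Fin n) ⟨0, by omega⟩
    exact this.1.trans this.2
  have hp1 : p ≤ 1 := by
    have := (Real.exp_pos (-(CHIP.maxEntry μ * T))).le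
    simp only [hp]
    linarith
  have hpΔ : p ≤ Δ := le_trans (by nlinarith) hΔ1
  set m : ℕ := ⌈max 1 c₀⁻¹ * Δ⌉₊ with hm
  have hmle : max 1 c₀⁻¹ * Δ ≤ m := Nat.le_ceil _
  have hm1 : 1 ≤ m := Nat.one_le_iff_ne_zero.2 (Nat.ceil_pos.2 (by positivity)).ne'
  have hΔm : Δ ≤ m := le_trans (by nlinarith) hmle
  have hmlog : Real.log n ≤ m := by
    refine le_trans ?_ hmle
    calc Real.log n = c₀⁻¹ * (c₀ * Real.log n) := by field_simp
      _ ≤ max 1 c₀⁻¹ * Δ := by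
        gcongr
        exact le_max_right _ _
  have hmκ : (m : ℝ) ≤ κ * Δ := by
    have h1 : (m : ℝ) < max 1 c₀⁻¹ * Δ + 1 := Nat.ceil_lt_add_one (by positivity)
    have h2 : 1 ≤ (c₀ * Real.log 2)⁻¹ * Δ := by
      rw [inv_mul_eq_div, le_div_iff₀ (by positivity)]
      linarith
    rw [hκ, add_mul]
    linarith
  have hBs : (Matrix.of fun a b => 1 - Real.exp (-(μ a b * T)) :
      Matrix (Fin k) (Fin k) ℝ).IsSymm := by
    ext a b
    simp [hC.mu_symm.apply a b]
  set bad : Set Ω := {ω | (400 * Real.exp 8 * m * Real.exp (r + 2)) ^ m ≤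
    (CHIP.symMatrix (fun e => CHIP.centeredEdge c μ t T e ω) ^ (2 * m)).trace} with hbad
  have hbadle : P.real bad ≤ (n : ℝ) ^ (-r) :=
    (CHIP.measure_trace_pow_ge_le hC.integral_prod_centeredEdge hC.measurable_centeredEdge
      (hC.abs_centeredEdge_le hT) (hC.integral_centeredEdge hT)
      (hC.integral_centeredEdge_sq_le hT) hp0 hp1 hm1 (hΔ1.trans hΔm) (r + 2)).trans
      (CHIP.two_mul_mul_exp_le hn hr hmlog)
  have hcompl : 1 - (n : ℝ) ^ (-r) ≤ P.real badᶜ := by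
    have h1 : P.real (bad ∪ badᶜ) ≤ P.real bad + P.real badᶜ := measureReal_union_le _ _
    rw [Set.union_compl_self, probReal_univ] at h1
    linarith
  refine hcompl.trans (measureReal_mono ?_)
  intro ω hω z hz
  have htr : (CHIP.symMatrix (fun e => CHIP.centeredEdge c μ t T e ω) ^ (2 * m)).trace ≤
      (K * m) ^ m := by
    rw [Set.mem_compl_iff, hbad, Set.mem_ofPred_eq, not_le] at hω
    have h2 : K * m = 400 * Real.exp 8 * m * Real.exp (r + 2) := by rw [hK]; ring
    rw [h2]
    exact hω.le
  have hdev : ∀ x, ((CHIP.adjacency T t ω - CHIP.meanAdjacency c μ T).mulVec x) ⬝ᵥ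
      ((CHIP.adjacency T t ω - CHIP.meanAdjacency c μ T).mulVec x) ≤
        ((2 * (K * κ) + 2) * Δ) * (x ⬝ᵥ x) := fun x => by
    refine (hC.deviation_le hT (by omega) (by positivity) htr x).trans ?_
    refine mul_le_mul_of_nonneg_right ?_ (dotProduct_self_nonneg_real x)
    have : K * m ≤ K * (κ * Δ) := by gcongr
    rw [← hp]
    linarith
  have := CHIP.misclusteringRate_le_of_operator_norm (c := c) hk hBs hrank hdev (by positivity)
    hε hz
  refine this.trans_eq ?_
  rw [← mul_assoc (_ * _ : ℝ) (2 * (K * κ) + 2) Δ]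
  rfl
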